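/- Let $1<p<\infty$ and $d\ge 2$, let $\Omega\subset\mathbb{R}^d$ be a bounded domain (a nonempty, connected, open set), and let $D\subset\Omega$ be an open set with Lipschitz boundary. Let $\sigma=1+\sigma_D\chi_D$ be measurable, where $\chi_D$ is the characteristic function of $D$ and either $c\le\sigma_D\le C$ on $D$, or $-1+c\le\sigma_D\le -c$ on $D$, for some constants $c>0$ and $C$. Put $X=W^{1,p}(\Omega)/W^{1,p}_0(\Omega)$ and, for a conductivity $\gamma$, let the weak Dirichlet-to-Neumann (DN) map $\Lambda_\gamma\colon X\to X'$ be given by $$\langle\Lambda_\gamma f,g\rangle=\int_\Omega\gamma|\nabla u|^{p-2}\nabla u\cdot\nabla v\,dx,$$ where $u\in W^{1,p}(\Omega)$ is a minimizer of $\int_\Omega\gamma|\nabla u|^p\,dx$ among the functions with boundary values $f$, and $v\in W^{1,p}(\Omega)$ is any function with boundary values $g$. Then $\Lambda_\sigma$ and $\Lambda_1$ are well defined, and the convex hull of $D$ and (if $D\neq\emptyset$) the sign of $\sigma_D$ can be recovered from $\Lambda_\sigma$, by the enclosure method with Wolff solutions. In detail, there are functions $w\in C^\infty(\mathbb{R})$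 with $(w(0),w'(0))\ne(0,0)$ and $$w''+V(w,w')\,w=0,\qquad V(a,b)=\frac{(2p-3)b^2+(p-1)a^2}{(p-1)b^2+a^2}.$$ Take any such $w$ and, for orthogonal unit vectors $\rho,\rho^\perp\in\mathbb{R}^d$, $t\in\mathbb{R}$ and $\tau>0$, put $$I(t,\rho,\rho^\perp,\tau)=\tau^{d-p}\langle\Lambda_\sigma f-\Lambda_1 f,f\rangle,$$ where $f\in X$ is the boundary value of $x\mapsto e^{\tau(\rho\cdot x-t)}w(\tau\rho^\perp\cdot x)$. Then: 1. The convex hull of $D$ is the interior of the intersection of all half-spaces $\{x:\rho\cdot x\le t\}$ for which $I(t,\rho,\rho^\perp,\tau)\to 0$ as $\tau\to\infty$ for some unit vector $\rho^\perp$ orthogonal to $\rho$. 2. If $D\ne\emptyset$, then for all $t,\rho,\rho^\perp$ and all $\tau>0$: $\sigma_D>0$ on $D$ if and only if $I(t,\rho,\rho^\perp,\tau)>0$, and $\sigma_D<0$ on $D$ if and only if $I(t,\rho,\rho^\perp,\tau)<0$. -/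

import Mathlib

open MeasureTheory Filter Topology
open scoped ENNReal NNReal ContDiff

noncomputable section

namespace PCalderon

/-- Euclidean space `ℝ^d`. -/
abbrev Space (d : ℕ) : Type := EuclideanSpace ℝ (Fin d)

/-- Test functions: `φ ∈ C_c^∞(Ω)`. -/
structure IsTestFunction {d : ℕ} (Ω : Set (Space d)) (φ : Space d → ℝ) : Prop where
  smooth : ContDiff ℝ ∞ φ
  compact : HasCompactSupport φ
  support : tsupport φ ⊆ Ω

/-- `G` is the weak (distributional) gradient of `u` in `Ω`: for every test function `φ` and
every direction `e`, `∫_Ω u ∂_e φ = - ∫_Ω φ (G · e)`. -/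
def HasWeakGradient {d : ℕ} (Ω : Set (Space d)) (u : Space d → ℝ) (G : Space d → Space d) :
    Prop :=
  ∀ φ : Space d → ℝ, IsTestFunction Ω φ → ∀ e : Space d,
    ∫ x in Ω, fderiv ℝ φ x e * u x = - ∫ x in Ω, φ x * inner ℝ (G x) e

theorem integrable_fderiv_mul {d : ℕ} {p : ℝ≥0∞} [Fact (1 ≤ p)] {Ω : Set (Space d)}
    {φ : Space d → ℝ} (hφ : IsTestFunction Ω φ) (e : Space d)
    (u : Lp ℝ p (volume.restrict Ω)) :
    Integrable (fun x => fderiv ℝ φ x e * u x) (volume.restrict Ω) := by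
  have h1 : LocallyIntegrable (u : Space d → ℝ) (volume.restrict Ω) :=
    (Lp.memLp u).locallyIntegrable Fact.out
  have h2 : Continuous (fun x => fderiv ℝ φ x e) :=
    (hφ.smooth.continuous_fderiv (by simp)).clm_apply continuous_const
  have h3 : HasCompactSupport (fun x => fderiv ℝ φ x e) := hφ.compact.fderiv_apply ℝ e
  exact h1.integrable_smul_left_of_hasCompactSupport h2 h3

theorem integrable_mul_inner {d : ℕ} {p : ℝ≥0∞} [Fact (1 ≤ p)] {Ω : Set (Space d)}
    {φ : Space d → ℝ} (hφ : IsTestFunction Ω φ) (e : Space d)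
    (G : Lp (Space d) p (volume.restrict Ω)) :
    Integrable (fun x => φ x * inner ℝ (G x) e) (volume.restrict Ω) := by
  have h1 : LocallyIntegrable (G : Space d → Space d) (volume.restrict Ω) :=
    (Lp.memLp G).locallyIntegrable Fact.out
  have h2 := h1.integrable_smul_left_of_hasCompactSupport hφ.smooth.continuous hφ.compact
  have h3 := h2.inner_const (𝕜 := ℝ) e
  simpa [real_inner_smul_left] using h3

/-- The Sobolev space `W^{1,p}(Ω)`: the pairs `(u, ∇u)` in `L^p(Ω) × L^p(Ω; ℝ^d)` where the second
component is the weak gradient of the first one. As a subspace of the product it carries (a norm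
equivalent to) the usual Sobolev norm. -/
def sobolev {d : ℕ} (p : ℝ≥0∞) [Fact (1 ≤ p)] (Ω : Set (Space d)) :
    Submodule ℝ (Lp ℝ p (volume.restrict Ω) × Lp (Space d) p (volume.restrict Ω)) where
  carrier := {f | HasWeakGradient Ω f.1 f.2}
  zero_mem' := by
    intro φ hφ e
    have h1 : ∫ x in Ω, fderiv ℝ φ x e * (0 : Lp ℝ p (volume.restrict Ω)) x = ∫ x in Ω, 0 := by
      refine integral_congr_ae ?_
      filter_upwards [Lp.coeFn_zero ℝ p (volume.restrict Ω)] with x hx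
      rw [hx]
      simp
    have h2 : ∫ x in Ω, φ x * inner ℝ ((0 : Lp (Space d) p (volume.restrict Ω)) x) e
        = ∫ x in Ω, 0 := by
      refine integral_congr_ae ?_
      filter_upwards [Lp.coeFn_zero (Space d) p (volume.restrict Ω)] with x hx
      rw [hx]
      simp
    simp only [Prod.fst_zero, Prod.snd_zero]
    rw [h1, h2]
    simp
  add_mem' := by
    intro f g hf hg φ hφ e
    have h1 : ∫ x in Ω, fderiv ℝ φ x e * (f.1 + g.1 : Lp ℝ p (volume.restrict Ω)) x
        = (∫ x in Ω, fderiv ℝ φ x e * f.1 x) + ∫ x in Ω, fderiv ℝ φ x e * g.1 x := by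
      rw [← integral_add (integrable_fderiv_mul hφ e f.1) (integrable_fderiv_mul hφ e g.1)]
      refine integral_congr_ae ?_
      filter_upwards [Lp.coeFn_add f.1 g.1] with x hx
      rw [hx, Pi.add_apply, mul_add]
    have h2 : ∫ x in Ω, φ x * inner ℝ ((f.2 + g.2 : Lp (Space d) p (volume.restrict Ω)) x) e
        = (∫ x in Ω, φ x * inner ℝ (f.2 x) e) + ∫ x in Ω, φ x * inner ℝ (g.2 x) e := by
      rw [← integral_add (integrable_mul_inner hφ e f.2) (integrable_mul_inner hφ e g.2)]
      refine integral_congr_ae ?_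
      filter_upwards [Lp.coeFn_add f.2 g.2] with x hx
      rw [hx, Pi.add_apply, inner_add_left, mul_add]
    simp only [Prod.fst_add, Prod.snd_add]
    rw [h1, h2, hf φ hφ e, hg φ hφ e]
    ring
  smul_mem' := by
    intro c f hf φ hφ e
    have h1 : ∫ x in Ω, fderiv ℝ φ x e * (c • f.1 : Lp ℝ p (volume.restrict Ω)) x
        = c * ∫ x in Ω, fderiv ℝ φ x e * f.1 x := by
      rw [← integral_const_mul]
      refine integral_congr_ae ?_
      filter_upwards [Lp.coeFn_smul c f.1] with x hx
      simp only [hx, Pi.smul_apply, smul_eq_mul]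
      ring
    have h2 : ∫ x in Ω, φ x * inner ℝ ((c • f.2 : Lp (Space d) p (volume.restrict Ω)) x) e
        = c * ∫ x in Ω, φ x * inner ℝ (f.2 x) e := by
      rw [← integral_const_mul]
      refine integral_congr_ae ?_
      filter_upwards [Lp.coeFn_smul c f.2] with x hx
      simp only [hx, Pi.smul_apply, real_inner_smul_left]
      ring
    simp only [Prod.smul_fst, Prod.smul_snd]
    rw [h1, h2, hf φ hφ e]
    ring

section Sobolev

variable {d : ℕ} {p : ℝ≥0∞} [Fact (1 ≤ p)] {Ω : Set (Space d)}

/-- The function underlying an element of `W^{1,p}(Ω)`. -/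
def toFun (u : sobolev p Ω) : Lp ℝ p (volume.restrict Ω) := u.1.1

/-- The weak gradient of an element of `W^{1,p}(Ω)`. -/
def grad (u : sobolev p Ω) : Lp (Space d) p (volume.restrict Ω) := u.1.2

end Sobolev

/-- `W^{1,p}_0(Ω)`: the closure of the test functions in `W^{1,p}(Ω)`. -/
def sobolevZero {d : ℕ} (p : ℝ≥0∞) [Fact (1 ≤ p)] (Ω : Set (Space d)) :
    Submodule ℝ (sobolev p Ω) :=
  (Submodule.span ℝ {u : sobolev p Ω |
    ∃ φ, IsTestFunction Ω φ ∧ toFun u =ᵐ[volume.restrict Ω] φ}).topologicalClosure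

/-- The space of boundary values `X = W^{1,p}(Ω) / W^{1,p}_0(Ω)`. -/
abbrev BoundaryValues {d : ℕ} (p : ℝ≥0∞) [Fact (1 ≤ p)] (Ω : Set (Space d)) : Type :=
  sobolev p Ω ⧸ sobolevZero p Ω

/-- The boundary values of an element of `W^{1,p}(Ω)`. -/
def trace {d : ℕ} {p : ℝ≥0∞} [Fact (1 ≤ p)] {Ω : Set (Space d)} (u : sobolev p Ω) :
    BoundaryValues p Ω :=
  (sobolevZero p Ω).mkQ u

open Classical in
/-- The boundary values of a function `f` whose restriction to `Ω` is in `W^{1,p}(Ω)`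
(and zero for other functions). -/
def traceOf {d : ℕ} (p : ℝ≥0∞) [Fact (1 ≤ p)] (Ω : Set (Space d)) (f : Space d → ℝ) :
    BoundaryValues p Ω :=
  if h : ∃ u : sobolev p Ω, toFun u =ᵐ[volume.restrict Ω] f then trace h.choose else 0

section Forward

variable {d : ℕ} {p : ℝ≥0∞} [Fact (1 ≤ p)] {Ω : Set (Space d)}

/-- The energy `E(u) = ∫_Ω σ |∇u|^p`. -/
def energy (σ : Space d → ℝ) (u : sobolev p Ω) : ℝ :=
  ∫ x in Ω, σ x * ‖grad u x‖ ^ p.toReal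

/-- `u` minimizes the energy among all functions in `u + W^{1,p}_0(Ω)`. -/
def IsMinimizer (σ : Space d → ℝ) (u : sobolev p Ω) : Prop :=
  ∀ v : sobolev p Ω, trace v = trace u → energy σ u ≤ energy σ v

/-- The pairing `∫_Ω σ |∇u|^{p-2} ∇u · ∇v`. -/
def fluxPairing (σ : Space d → ℝ) (u v : sobolev p Ω) : ℝ :=
  ∫ x in Ω, σ x * ‖grad u x‖ ^ (p.toReal - 2) * inner ℝ (grad u x) (grad v x)

/-- `Λ : X → X'` is the weak Dirichlet-to-Neumann map of the conductivity `σ`: every boundary value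
has an energy minimizer, and `⟨Λ f, g⟩ = ∫_Ω σ |∇u|^{p-2} ∇u · ∇v` whenever `u` is a
minimizer with boundary values `f` and `v ∈ W^{1,p}(Ω)` has boundary values `g`. These
properties determine `Λ`. -/
structure IsDNMap (σ : Space d → ℝ)
    (Λ : BoundaryValues p Ω → StrongDual ℝ (BoundaryValues p Ω)) : Prop where
  exists_minimizer : ∀ f : BoundaryValues p Ω, ∃ u : sobolev p Ω, trace u = f ∧ IsMinimizer σ u
  pairing : ∀ u v : sobolev p Ω, IsMinimizer σ u → Λ (trace u) (trace v) = fluxPairing σ u v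

end Forward

open Classical in
/-- The Dirichlet-to-Neumann map `Λ_σ : X → X'` (zero for those `σ` for which there is none). -/
def dnMap {d : ℕ} (p : ℝ≥0∞) [Fact (1 ≤ p)] (Ω : Set (Space d)) (σ : Space d → ℝ) :
    BoundaryValues p Ω → StrongDual ℝ (BoundaryValues p Ω) :=
  if h : ∃ Λ : BoundaryValues p Ω → StrongDual ℝ (BoundaryValues p Ω), IsDNMap σ Λ
  then h.choose else 0

/-- An open set has Lipschitz boundary: near each boundary point, it is the region on one side
of the graph of a Lipschitz function over a hyperplane `e^⊥`. -/
def HasLipschitzBoundary {d : ℕ} (D : Set (Space d)) : Prop :=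
  ∀ x ∈ frontier D, ∃ (e : Space d) (r : ℝ) (K : ℝ≥0) (g : (ℝ ∙ e)ᗮ → ℝ),
    ‖e‖ = 1 ∧ 0 < r ∧ LipschitzWith K g ∧
      ∀ y ∈ Metric.ball x r, y ∈ D ↔ g ((ℝ ∙ e)ᗮ.orthogonalProjectionOnto y) < inner ℝ e y

/-- The conductivity `σ = 1 + σ_D χ_D`. -/
def inclusionConductivity {d : ℕ} (D : Set (Space d)) (σD : Space d → ℝ) : Space d → ℝ :=
  fun x => 1 + D.indicator σD x

/-- `V(a, b) = ((2p-3) b² + (p-1) a²) / ((p-1) b² + a²)`. -/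
def wolffV (p a b : ℝ) : ℝ :=
  ((2 * p - 3) * b ^ 2 + (p - 1) * a ^ 2) / ((p - 1) * b ^ 2 + a ^ 2)

/-- `w` is a Wolff function: a smooth solution of `w'' + V(w, w') w = 0` with
`(w(0), w'(0)) ≠ (0, 0)`. -/
structure IsWolffFunction (p : ℝ) (w : ℝ → ℝ) : Prop where
  smooth : ContDiff ℝ ∞ w
  ode : ∀ s : ℝ, deriv (deriv w) s + wolffV p (w s) (deriv w s) * w s = 0
  nontrivial : w 0 ≠ 0 ∨ deriv w 0 ≠ 0

/-- The Wolff solution `x ↦ exp(τ (ρ · x - t)) w(τ ρ^⊥ · x)`. -/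
def wolffSolution {d : ℕ} (w : ℝ → ℝ) (t : ℝ) (ρ ρ' : Space d) (τ : ℝ) : Space d → ℝ :=
  fun x => Real.exp (τ * (inner ℝ ρ x - t)) * w (τ * inner ℝ ρ' x)

/-- The indicator function `I(t, ρ, ρ^⊥, τ) = τ^{d-p} ⟨(Λ - Λ_1) f, f⟩`, where `f` is the boundary
value of the Wolff solution. -/
def indicatorFunction {d : ℕ} (p : ℝ≥0∞) [Fact (1 ≤ p)] (Ω : Set (Space d)) (w : ℝ → ℝ)
    (Λ : BoundaryValues p Ω → StrongDual ℝ (BoundaryValues p Ω))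
    (t : ℝ) (ρ ρ' : Space d) (τ : ℝ) : ℝ :=
  τ ^ ((d : ℝ) - p.toReal) *
    (Λ (traceOf p Ω (wolffSolution w t ρ ρ' τ)) -
      dnMap p Ω 1 (traceOf p Ω (wolffSolution w t ρ ρ' τ)))
      (traceOf p Ω (wolffSolution w t ρ ρ' τ))

/-- The set that the enclosure method reads off a boundary map `Λ : X → X'`: the interior of the
intersection of all half-spaces `{x | ρ · x ≤ t}` for which the indicator function
`I(t, ρ, ρ^⊥, τ)` tends to zero as `τ → ∞`. -/
def enclosure {d : ℕ} (p : ℝ≥0∞) [Fact (1 ≤ p)] (Ω : Set (Space d)) (w : ℝ → ℝ)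
    (Λ : BoundaryValues p Ω → StrongDual ℝ (BoundaryValues p Ω)) : Set (Space d) :=
  interior {x | ∀ (ρ ρ' : Space d) (t : ℝ), ‖ρ‖ = 1 → ‖ρ'‖ = 1 → inner ℝ ρ ρ' = 0 →
    Tendsto (fun τ => indicatorFunction p Ω w Λ t ρ ρ' τ) atTop (𝓝 0) → inner ℝ ρ x ≤ t}

end PCalderon

end

/-!
The direct method yields minimizers, and the Euler-Lagrange equation makes the boundary pairing
independent of the chosen extension `v`, so the Dirichlet-to-Neumann maps exist. If `u` minimizes
the background energy, then testing the `σ`-energy with `u` bounds `⟨(Λ_σ - Λ_1) f, f⟩` from above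
by `∫ (σ - 1) |∇u|^p`, while Young's inequality against the `σ`-minimizer gives the dual lower
bound `(p - 1) ∫ (1 - σ^{-1/(p-1)}) |∇u|^p`. Both integrands live on `D` and have the sign of
`σ_D`, so the pairing is comparable with `∫_D |∇u|^p`.

For a Wolff solution, `|∇u| = τ e^{τ(ρ·x-t)} (w² + w'²)^{1/2}`, and `w² + w'²` is bounded above
and away from zero because the equation of `w` has the first integral
`log (w² + w'²) + (2-p)/(p-1) · w'²/(w² + w'²)`. Hence the indicator function is comparable with
`τ^d ∫_D e^{pτ(ρ·x-t)} dx`. This tends to zero if `D` lies in a smaller parallel half-space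
`{ρ·x ≤ s}`, `s < t`, and stays bounded below if `D` leaves `{ρ·x ≤ t}`; by hyperplane separation
such half-spaces cut out the closed convex hull of `D`, whose interior is the convex hull because
`D` is open.
-/

noncomputable section

namespace PCalderon

section DirectMethod

theorem exists_forall_le_mul_of_isCompact {X : Type*} [TopologicalSpace X] {s : Set X}
    (hs : IsCompact s) {f g : X → ℝ} (hf : Continuous f) (hg : Continuous g)
    (hg₀ : ∀ x ∈ s, 0 ≤ g x) (hfg : ∀ x ∈ s, 0 ≤ f x → 0 < g x) :
    ∃ C : ℝ, 0 ≤ C ∧ ∀ x ∈ s, f x ≤ C * g x := by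
  have hcompact : IsCompact (s ∩ {x | 0 ≤ f x}) := hs.inter_right (isClosed_le continuous_const hf)
  obtain ⟨C, hC⟩ := hcompact.bddAbove_image
    (hf.continuousOn.div hg.continuousOn fun x hx => (hfg x hx.1 hx.2).ne')
  refine ⟨max C 0, le_max_right _ _, fun x hx => ?_⟩
  by_cases hfx : 0 ≤ f x
  · rw [← div_le_iff₀ (hfg x hx hfx)]
    exact (hC ⟨x, ⟨hx, hfx⟩, rfl⟩).trans (le_max_left _ _)
  · exact (not_le.1 hfx).le.trans (mul_nonneg (le_max_right _ _) (hg₀ x hx))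

theorem exists_forall_le_mul_of_homogeneous {V : Type*} [NormedAddCommGroup V] [NormedSpace ℝ V]
    [FiniteDimensional ℝ V] {P : ℝ} (hP : P ≠ 0) {f g : V → ℝ} (hf : Continuous f)
    (hg : Continuous g) (hf_smul : ∀ r : ℝ, 0 ≤ r → ∀ v, f (r • v) = r ^ P * f v)
    (hg_smul : ∀ r : ℝ, 0 ≤ r → ∀ v, g (r • v) = r ^ P * g v) (hg₀ : ∀ v, 0 ≤ g v)
    (hfg : ∀ v ≠ 0, 0 ≤ f v → 0 < g v) :
    ∃ C : ℝ, 0 ≤ C ∧ ∀ v, f v ≤ C * g v := by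
  have : ProperSpace V := FiniteDimensional.proper ℝ V
  obtain ⟨C, hC₀, hC⟩ := exists_forall_le_mul_of_isCompact (isCompact_sphere (0 : V) 1) hf hg
    (fun v _ => hg₀ v) fun v hv => hfg v (ne_zero_of_mem_unit_sphere ⟨v, hv⟩)
  refine ⟨C, hC₀, fun v => ?_⟩
  rcases eq_or_ne v 0 with rfl | hv
  · have hf_zero : f 0 = 0 := by simpa [Real.zero_rpow hP] using hf_smul 0 le_rfl 0
    rw [hf_zero]
    exact mul_nonneg hC₀ (hg₀ 0)
  · have hsphere : ‖v‖⁻¹ • v ∈ Metric.sphere (0 : V) 1 := by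
      rw [mem_sphere_zero_iff_norm, norm_smul, norm_inv, norm_norm,
        inv_mul_cancel₀ (norm_ne_zero_iff.2 hv)]
    calc f v = f (‖v‖ • ‖v‖⁻¹ • v) := by rw [smul_inv_smul₀ (norm_ne_zero_iff.2 hv)]
      _ = ‖v‖ ^ P * f (‖v‖⁻¹ • v) := hf_smul _ (norm_nonneg v) _
      _ ≤ ‖v‖ ^ P * (C * g (‖v‖⁻¹ • v)) := by gcongr; exact hC _ hsphere
      _ = C * g (‖v‖ • ‖v‖⁻¹ • v) := by rw [hg_smul _ (norm_nonneg v)]; ring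
      _ = C * g v := by rw [smul_inv_smul₀ (norm_ne_zero_iff.2 hv)]

/-- Quantitative strict convexity of a functional `J`: up to an arbitrarily small fraction of the
values, the defect in midpoint convexity controls the distance. It holds for `‖·‖ ^ P` and is
inherited by the energies `∫ σ ‖·‖ ^ P`; it is what the direct method needs. -/
def UniformMidpointConvex {V : Type*} [NormedAddCommGroup V] [NormedSpace ℝ V] (P : ℝ)
    (J : V → ℝ) : Prop :=
  ∀ ε : ℝ, 0 < ε → ∃ K : ℝ, 0 ≤ K ∧ ∀ v w, ‖v - w‖ ^ P
    ≤ ε * (J v + J w) + K * ((J v + J w) / 2 - J (midpoint ℝ v w))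

variable {V : Type*} [NormedAddCommGroup V] [NormedSpace ℝ V] {P : ℝ} {J : V → ℝ}

theorem UniformMidpointConvex.cauchySeq (hJ : UniformMidpointConvex P J) (hP : 0 < P) {m : ℝ}
    {u : ℕ → V} (hu : Tendsto (fun n => J (u n)) atTop (𝓝 m))
    (hmid : ∀ i j, m ≤ J (midpoint ℝ (u i) (u j))) : CauchySeq u := by
  rw [cauchySeq_iff_tendsto_dist_atTop_0]
  refine tendsto_order.2 ⟨fun c hc => Eventually.of_forall fun _ => hc.trans_le dist_nonneg,
    fun δ hδ => ?_⟩
  obtain ⟨ε, hε, hεm⟩ : ∃ ε : ℝ, 0 < ε ∧ ε * (m + m) < δ ^ P := by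
    have hlim : Tendsto (fun ε : ℝ => ε * (m + m)) (𝓝[>] 0) (𝓝 (0 * (m + m))) :=
      (tendsto_id.mul_const _).mono_left nhdsWithin_le_nhds
    rw [zero_mul] at hlim
    exact (eventually_mem_nhdsWithin.and
      (hlim.eventually_lt_const (Real.rpow_pos_of_pos hδ P))).exists
  obtain ⟨K, hK₀, hK⟩ := hJ ε hε
  have hsum : Tendsto (fun n : ℕ × ℕ => J (u n.1) + J (u n.2)) atTop (𝓝 (m + m)) := by
    rw [← prod_atTop_atTop_eq]
    exact (hu.comp tendsto_fst).add (hu.comp tendsto_snd)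
  have hbound : Tendsto (fun n : ℕ × ℕ => ε * (J (u n.1) + J (u n.2))
      + K * ((J (u n.1) + J (u n.2)) / 2 - m)) atTop (𝓝 (ε * (m + m))) := by
    simpa using (hsum.const_mul ε).add (((hsum.div_const 2).sub_const m).const_mul K)
  filter_upwards [hbound.eventually_lt_const hεm] with n hn
  rw [dist_eq_norm]
  refine lt_of_not_ge fun hge => hn.not_ge ?_
  calc δ ^ P ≤ ‖u n.1 - u n.2‖ ^ P := by gcongr
    _ ≤ _ := hK _ _
    _ ≤ _ := by gcongr; exact hmid _ _

theorem UniformMidpointConvex.exists_isMinOn [CompleteSpace V] (hJ : UniformMidpointConvex P J)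
    (hP : 0 < P) (hlsc : LowerSemicontinuous J) {S : Set V} (hS : Convex ℝ S)
    (hS_closed : IsClosed S) (hS_ne : S.Nonempty) (hbdd : BddBelow (J '' S)) :
    ∃ v ∈ S, IsMinOn J S v := by
  have hm : ∀ v ∈ S, sInf (J '' S) ≤ J v := fun v hv => csInf_le hbdd ⟨v, hv, rfl⟩
  obtain ⟨y, -, hy, hyS⟩ := exists_seq_tendsto_sInf (hS_ne.image J) hbdd
  choose u huS hu using hyS
  obtain rfl : y = fun n => J (u n) := funext fun n => (hu n).symm
  obtain ⟨v, hv⟩ := cauchySeq_tendsto_of_complete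
    (hJ.cauchySeq hP hy fun i j => hm _ (hS.midpoint_mem (huS i) (huS j)))
  refine ⟨v, hS_closed.mem_of_tendsto hv (Eventually.of_forall huS), fun w hw => ?_⟩
  refine le_trans (le_of_forall_lt_imp_le_of_dense fun c hc => ?_) (hm w hw)
  exact ge_of_tendsto hy ((hv.eventually (hlsc v c hc)).mono fun n hn => hn.le)

theorem UniformMidpointConvex.eq_of_le_midpoint (hJ : UniformMidpointConvex P J) (hP : P ≠ 0)
    {v w : V} (hv : J v ≤ J (midpoint ℝ v w)) (hw : J w ≤ J (midpoint ℝ v w)) : v = w := by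
  have hle : ∀ ε : ℝ, 0 < ε → ‖v - w‖ ^ P ≤ ε * (J v + J w) := fun ε hε => by
    obtain ⟨K, hK₀, hK⟩ := hJ ε hε
    have hdefect : K * ((J v + J w) / 2 - J (midpoint ℝ v w)) ≤ 0 :=
      mul_nonpos_of_nonneg_of_nonpos hK₀ (by linarith)
    linarith [hK v w]
  have hlim : Tendsto (fun ε : ℝ => ε * (J v + J w)) (𝓝[>] 0) (𝓝 (0 * (J v + J w))) :=
    (tendsto_id.mul_const _).mono_left nhdsWithin_le_nhds
  have hzero : ‖v - w‖ ^ P ≤ 0 := by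
    rw [← zero_mul (J v + J w)]
    exact ge_of_tendsto hlim (eventually_mem_nhdsWithin.mono hle)
  have hzero' := le_antisymm hzero (by positivity)
  rw [Real.rpow_eq_zero (norm_nonneg _) hP] at hzero'
  exact sub_eq_zero.1 (norm_eq_zero.1 hzero')

end DirectMethod

section NormRpow

theorem norm_midpoint_le {E : Type*} [SeminormedAddCommGroup E] [NormedSpace ℝ E] (a b : E) :
    ‖midpoint ℝ a b‖ ≤ (‖a‖ + ‖b‖) / 2 := by
  rw [midpoint_eq_smul_add, norm_smul, invOf_eq_inv, norm_inv, Real.norm_ofNat,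
    inv_mul_eq_div]
  gcongr
  exact norm_add_le a b

theorem norm_midpoint_rpow_lt {E : Type*} [NormedAddCommGroup E] [NormedSpace ℝ E]
    [StrictConvexSpace ℝ E] {P : ℝ} (hP : 1 < P) {a b : E} (hab : a ≠ b) :
    ‖midpoint ℝ a b‖ ^ P < (‖a‖ ^ P + ‖b‖ ^ P) / 2 := by
  by_cases hn : ‖a‖ = ‖b‖
  · have hlt : ‖midpoint ℝ a b‖ < ‖a‖ := by
      rw [midpoint_eq_smul_add, invOf_eq_inv, ← one_div]
      exact (norm_midpoint_lt_iff hn).2 hab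
    rw [← hn, add_self_div_two]
    gcongr
  · calc ‖midpoint ℝ a b‖ ^ P ≤ ((‖a‖ + ‖b‖) / 2) ^ P := by gcongr; exact norm_midpoint_le a b
      _ = ((1 / 2 : ℝ) • ‖a‖ + (1 / 2 : ℝ) • ‖b‖) ^ P := by simp only [smul_eq_mul]; ring_nf
      _ < (1 / 2 : ℝ) • ‖a‖ ^ P + (1 / 2 : ℝ) • ‖b‖ ^ P :=
        (strictConvexOn_rpow hP).2 (norm_nonneg a) (norm_nonneg b) hn (by norm_num) (by norm_num)
          (by norm_num)
      _ = (‖a‖ ^ P + ‖b‖ ^ P) / 2 := by simp only [smul_eq_mul]; ring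

theorem uniformMidpointConvex_norm_rpow {E : Type*} [NormedAddCommGroup E] [NormedSpace ℝ E]
    [FiniteDimensional ℝ E] [StrictConvexSpace ℝ E] {P : ℝ} (hP : 1 < P) :
    UniformMidpointConvex P fun a : E => ‖a‖ ^ P := by
  intro ε hε
  have hP₀ : 0 < P := zero_lt_one.trans hP
  have hcont : ∀ {h : E × E → E}, Continuous h → Continuous fun z => ‖h z‖ ^ P := fun hh =>
    hh.norm.rpow_const fun _ => Or.inr hP₀.le
  have hhom : ∀ r : ℝ, 0 ≤ r → ∀ c : E, ‖r • c‖ ^ P = r ^ P * ‖c‖ ^ P := fun r hr c => by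
    rw [norm_smul, Real.norm_of_nonneg hr, Real.mul_rpow hr (norm_nonneg c)]
  have hsum : Continuous fun z : E × E => ‖z.1‖ ^ P + ‖z.2‖ ^ P :=
    (hcont continuous_fst).add (hcont continuous_snd)
  obtain ⟨K, hK₀, hK⟩ := exists_forall_le_mul_of_homogeneous (V := E × E) hP₀.ne'
    (f := fun z => ‖z.1 - z.2‖ ^ P - ε * (‖z.1‖ ^ P + ‖z.2‖ ^ P))
    (g := fun z => (‖z.1‖ ^ P + ‖z.2‖ ^ P) / 2 - ‖(⅟2 : ℝ) • (z.1 + z.2)‖ ^ P)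
    ((hcont (by fun_prop)).sub (hsum.const_mul ε)) ((hsum.div_const 2).sub (hcont (by fun_prop)))
    (fun r hr z => by
      simp only [Prod.smul_fst, Prod.smul_snd, ← smul_sub, hhom r hr]
      ring)
    (fun r hr z => by
      simp only [Prod.smul_fst, Prod.smul_snd, ← smul_add, smul_comm (⅟2 : ℝ) r, hhom r hr]
      ring)
    (fun z => by
      rw [← midpoint_eq_smul_add, sub_nonneg]
      rcases eq_or_ne z.1 z.2 with heq | hne
      · rw [heq, midpoint_self, add_self_div_two]
      · exact (norm_midpoint_rpow_lt hP hne).le)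
    (fun z hz hfz => by
      rw [← midpoint_eq_smul_add, sub_pos]
      refine norm_midpoint_rpow_lt hP fun heq => ?_
      have hz₂ : z.2 ≠ 0 := fun h₂ => hz (Prod.ext (heq.trans h₂) h₂)
      simp only [heq, sub_self, norm_zero, Real.zero_rpow hP₀.ne'] at hfz
      have : 0 < ‖z.2‖ ^ P := Real.rpow_pos_of_pos (norm_pos_iff.2 hz₂) P
      nlinarith)
  refine ⟨K, hK₀, fun a b => ?_⟩
  rw [midpoint_eq_smul_add]
  linarith [hK (a, b)]

variable {E : Type*} [NormedAddCommGroup E] [InnerProductSpace ℝ E] {P : ℝ}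

theorem norm_rpow_sub_two_mul_inner_self (hP : P ≠ 0) (a : E) :
    ‖a‖ ^ (P - 2) * inner ℝ a a = ‖a‖ ^ P := by
  rw [real_inner_self_eq_norm_sq, ← Real.rpow_two, ← Real.rpow_add' (norm_nonneg a) (by simpa)]
  ring_nf

theorem rpow_sub_two_mul_self (hP : P ≠ 1) {x : ℝ} (hx : 0 ≤ x) :
    x ^ (P - 2) * x = x ^ (P - 1) := by
  have hP' : P - 2 + 1 ≠ 0 := fun h => hP (by linarith)
  rw [← Real.rpow_add_one' hx hP']
  ring_nf

theorem abs_norm_rpow_mul_inner_le (hP : P ≠ 1) (a b : E) :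
    |‖a‖ ^ (P - 2) * inner ℝ a b| ≤ ‖a‖ ^ (P - 1) * ‖b‖ := by
  rw [abs_mul, abs_of_nonneg (by positivity), ← rpow_sub_two_mul_self hP (norm_nonneg a),
    mul_assoc]
  gcongr
  exact abs_real_inner_le_norm a b

theorem young_inequality_weighted (hP : 1 < P) {s x y : ℝ} (hs : 0 < s) (hx : 0 ≤ x)
    (hy : 0 ≤ y) :
    P * (x ^ (P - 1) * y) ≤ s * y ^ P + (P - 1) * s ^ (-1 / (P - 1)) * x ^ P := by
  have hP₀ : 0 < P := by linarith
  have hP₁ : 0 < P - 1 := by linarith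
  have hprod : s ^ (1 / P) * y * (s ^ (-1 / P) * x ^ (P - 1)) = x ^ (P - 1) * y := by
    have hs_cancel : s ^ (1 / P) * s ^ (-1 / P) = 1 := by
      rw [← Real.rpow_add hs]; simp [neg_div]
    linear_combination x ^ (P - 1) * y * hs_cancel
  have hleft : (s ^ (1 / P) * y) ^ P = s * y ^ P := by
    rw [Real.mul_rpow (by positivity) hy, ← Real.rpow_mul hs.le]
    simp [hP₀.ne']
  have hright : (s ^ (-1 / P) * x ^ (P - 1)) ^ P.conjExponent = s ^ (-1 / (P - 1)) * x ^ P := by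
    rw [Real.mul_rpow (by positivity) (by positivity), ← Real.rpow_mul hs.le,
      ← Real.rpow_mul hx, Real.conjExponent]
    congr 2 <;> field_simp
  have hyoung := Real.young_inequality_of_nonneg (a := s ^ (1 / P) * y)
    (b := s ^ (-1 / P) * x ^ (P - 1)) (by positivity) (by positivity)
    (Real.HolderConjugate.conjExponent hP)
  rw [hprod, hleft, hright, Real.conjExponent] at hyoung
  calc P * (x ^ (P - 1) * y)
      ≤ P * (s * y ^ P / P + s ^ (-1 / (P - 1)) * x ^ P / (P / (P - 1))) := by gcongr
    _ = s * y ^ P + (P - 1) * s ^ (-1 / (P - 1)) * x ^ P := by field_simp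

theorem norm_rpow_mul_inner_le_weighted (hP : 1 < P) {s : ℝ} (hs : 0 < s) (a b : E) :
    P * (‖a‖ ^ (P - 2) * inner ℝ a b)
      ≤ s * ‖b‖ ^ P + (P - 1) * s ^ (-1 / (P - 1)) * ‖a‖ ^ P := by
  refine le_trans ?_ (young_inequality_weighted hP hs (norm_nonneg a) (norm_nonneg b))
  exact mul_le_mul_of_nonneg_left
    ((le_abs_self _).trans (abs_norm_rpow_mul_inner_le hP.ne' a b)) (by linarith)

theorem norm_rpow_le_norm_rpow_add (hP : 1 < P) (a b : E) :
    ‖a‖ ^ P ≤ ‖b‖ ^ P + P * (‖a‖ ^ (P - 2) * inner ℝ a (a - b)) := by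
  have hyoung := norm_rpow_mul_inner_le_weighted hP one_pos a b
  simp only [Real.one_rpow] at hyoung
  rw [inner_sub_right, mul_sub, norm_rpow_sub_two_mul_inner_self (by linarith)]
  linarith

theorem continuous_norm_rpow_smul (hP : 1 < P) :
    Continuous fun a : E => ‖a‖ ^ (P - 2) • a := by
  refine continuous_iff_continuousAt.2 fun a => ?_
  rcases eq_or_ne a 0 with rfl | ha
  · rw [ContinuousAt, smul_zero, tendsto_zero_iff_norm_tendsto_zero]
    have hnorm : ∀ a : E, ‖‖a‖ ^ (P - 2) • a‖ = ‖a‖ ^ (P - 1) := fun a => by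
      rw [norm_smul, Real.norm_of_nonneg (by positivity),
        rpow_sub_two_mul_self hP.ne' (norm_nonneg a)]
    have hcont : Continuous fun a : E => ‖a‖ ^ (P - 1) :=
      continuous_norm.rpow_const fun _ => Or.inr (by linarith)
    simp only [hnorm]
    simpa [Real.zero_rpow (by linarith : P - 1 ≠ 0)] using hcont.tendsto 0
  · exact (continuousAt_id.norm.rpow_const (Or.inl (by simpa using ha))).smul continuousAt_id

end NormRpow

/-- An admissible weight `σ`: measurable, bounded above and bounded away from zero. -/
structure IsElliptic {α : Type*} [MeasurableSpace α] (σ : α → ℝ) : Prop where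
  measurable : Measurable σ
  lower : ∃ m : ℝ, 0 < m ∧ ∀ x, m ≤ σ x
  upper : ∃ M : ℝ, ∀ x, σ x ≤ M

theorem one_lt_toReal {p : ℝ≥0∞} (hp₁ : 1 < p) (hp : p ≠ ⊤) : 1 < p.toReal := by
  simpa using (ENNReal.toReal_lt_toReal ENNReal.one_ne_top hp).2 hp₁

section LpEnergy

variable {α E : Type*} [MeasurableSpace α] {μ : Measure α}
  [NormedAddCommGroup E] {p : ℝ≥0∞} {σ : α → ℝ}

theorem IsElliptic.pos (hσ : IsElliptic σ) (x : α) : 0 < σ x := by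
  obtain ⟨m, hm, hmσ⟩ := hσ.lower
  exact hm.trans_le (hmσ x)

theorem IsElliptic.integrable_mul (hσ : IsElliptic σ) {f : α → ℝ} (hf : Integrable f μ) :
    Integrable (fun x => σ x * f x) μ := by
  obtain ⟨M, hM⟩ := hσ.upper
  refine hf.bdd_mul (c := M) hσ.measurable.aestronglyMeasurable (ae_of_all _ fun x => ?_)
  rw [Real.norm_of_nonneg (hσ.pos x).le]
  exact hM x

theorem isElliptic_one : IsElliptic (1 : α → ℝ) :=
  ⟨measurable_one, ⟨1, one_pos, fun _ => le_rfl⟩, ⟨1, fun _ => le_rfl⟩⟩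

theorem Lp_norm_rpow_eq_integral (hp₀ : p ≠ 0) (hp : p ≠ ⊤) (G : Lp E p μ) :
    ‖G‖ ^ p.toReal = ∫ x, ‖G x‖ ^ p.toReal ∂μ := by
  have hnonneg : 0 ≤ ∫ x, ‖G x‖ ^ p.toReal ∂μ := integral_nonneg fun x => by positivity
  rw [Lp.norm_def, (Lp.memLp G).eLpNorm_eq_integral_rpow_norm hp₀ hp,
    ENNReal.toReal_ofReal (by positivity), ← Real.rpow_mul hnonneg,
    inv_mul_cancel₀ (ENNReal.toReal_ne_zero.2 ⟨hp₀, hp⟩), Real.rpow_one]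

/-- The weighted energy `∫ σ ‖G‖ ^ p` of an `L^p` vector field `G`. -/
def lpEnergy (σ : α → ℝ) (G : Lp E p μ) : ℝ := ∫ x, σ x * ‖G x‖ ^ p.toReal ∂μ

theorem integrable_lpEnergy (hp₀ : p ≠ 0) (hp : p ≠ ⊤) (hσ : IsElliptic σ) (G : Lp E p μ) :
    Integrable (fun x => σ x * ‖G x‖ ^ p.toReal) μ :=
  hσ.integrable_mul ((Lp.memLp G).integrable_norm_rpow hp₀ hp)

theorem lpEnergy_nonneg (hσ : IsElliptic σ) (G : Lp E p μ) : 0 ≤ lpEnergy σ G :=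
  integral_nonneg fun x => mul_nonneg (hσ.pos x).le (by positivity)

theorem coeFn_midpoint [NormedSpace ℝ E] (G H : Lp E p μ) :
    ⇑(midpoint ℝ G H) =ᵐ[μ] fun x => midpoint ℝ (G x) (H x) := by
  rw [midpoint_eq_smul_add]
  filter_upwards [Lp.coeFn_smul (⅟2 : ℝ) (G + H), Lp.coeFn_add G H] with x hsmul hadd
  rw [hsmul, Pi.smul_apply, hadd, Pi.add_apply, midpoint_eq_smul_add]

theorem UniformMidpointConvex.lpEnergy [NormedSpace ℝ E] [Fact (1 ≤ p)] (hp : p ≠ ⊤)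
    (hσ : IsElliptic σ) (hE : UniformMidpointConvex p.toReal fun a : E => ‖a‖ ^ p.toReal) :
    UniformMidpointConvex p.toReal (lpEnergy σ : Lp E p μ → ℝ) := by
  intro ε hε
  have hp₀ : p ≠ 0 := (zero_lt_one.trans_le Fact.out).ne'
  obtain ⟨m, hm, hmσ⟩ := hσ.lower
  obtain ⟨K, hK₀, hK⟩ := hE (m * ε) (by positivity)
  refine ⟨K / m, by positivity, fun G H => ?_⟩
  let e : Lp E p μ → α → ℝ := fun F x => σ x * ‖F x‖ ^ p.toReal
  have hG : Integrable (e G) μ := integrable_lpEnergy hp₀ hp hσ G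
  have hH : Integrable (e H) μ := integrable_lpEnergy hp₀ hp hσ H
  have hM : Integrable (e (midpoint ℝ G H)) μ := integrable_lpEnergy hp₀ hp hσ _
  let rhs : α → ℝ := fun x =>
    m * ε * (e G x + e H x) + K * ((e G x + e H x) / 2 - e (midpoint ℝ G H) x)
  have hsum : Integrable (fun x => e G x + e H x) μ := hG.add hH
  have hdefect : Integrable (fun x => (e G x + e H x) / 2 - e (midpoint ℝ G H) x) μ :=
    (hsum.div_const 2).sub hM
  have hrhs : Integrable rhs μ := (hsum.const_mul _).add (hdefect.const_mul K)
  have hpointwise : ∀ᵐ x ∂μ, m * ‖(G - H) x‖ ^ p.toReal ≤ rhs x := by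
    filter_upwards [Lp.coeFn_sub G H, coeFn_midpoint G H] with x hsub hmid
    simp only [rhs, e, hsub, hmid, Pi.sub_apply]
    calc m * ‖G x - H x‖ ^ p.toReal ≤ σ x * ‖G x - H x‖ ^ p.toReal := by gcongr; exact hmσ x
      _ ≤ σ x * _ := mul_le_mul_of_nonneg_left (hK (G x) (H x)) (hσ.pos x).le
      _ = _ := by ring
  refine le_of_mul_le_mul_left ?_ hm
  calc m * ‖G - H‖ ^ p.toReal = ∫ x, m * ‖(G - H) x‖ ^ p.toReal ∂μ := by
        rw [Lp_norm_rpow_eq_integral hp₀ hp, integral_const_mul]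
    _ ≤ ∫ x, rhs x ∂μ := integral_mono_ae
        (((Lp.memLp (G - H)).integrable_norm_rpow hp₀ hp).const_mul m) hrhs hpointwise
    _ = m * ε * ((∫ x, e G x ∂μ) + ∫ x, e H x ∂μ)
        + K * (((∫ x, e G x ∂μ) + ∫ x, e H x ∂μ) / 2 - ∫ x, e (midpoint ℝ G H) x ∂μ) := by
      rw [integral_add (hsum.const_mul _) (hdefect.const_mul K), integral_const_mul,
        integral_const_mul, integral_sub (hsum.div_const 2) hM, integral_div,
        integral_add hG hH]
    _ = _ := by simp only [e, PCalderon.lpEnergy]; field_simp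

variable [InnerProductSpace ℝ E]

/-- The pairing `∫ σ ‖G‖ ^ (p - 2) G · H`, which is `1 / p` times the derivative of `lpEnergy σ`
at `G` in direction `H`. -/
def lpFlux (σ : α → ℝ) (G H : Lp E p μ) : ℝ :=
  ∫ x, σ x * ‖G x‖ ^ (p.toReal - 2) * inner ℝ (G x) (H x) ∂μ

theorem memLp_flux (hp₁ : 1 < p) (hp : p ≠ ⊤) (hσ : IsElliptic σ) {G : α → E}
    (hG : MemLp G p μ) :
    MemLp (fun x => (σ x * ‖G x‖ ^ (p.toReal - 2)) • G x) (ENNReal.conjExponent p) μ := by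
  have hP := one_lt_toReal hp₁ hp
  have hpow := hG.norm_rpow_div (p - 1)
  have hsub : (p - 1).toReal = p.toReal - 1 := by
    rw [ENNReal.toReal_sub_of_le hp₁.le hp, ENNReal.toReal_one]
  have hconj : p / (p - 1) = ENNReal.conjExponent p := by
    rw [ENNReal.conjExponent]
    nth_rewrite 1 [← tsub_add_cancel_of_le hp₁.le]
    rw [ENNReal.add_div, ENNReal.div_self (tsub_pos_of_lt hp₁).ne' (ENNReal.sub_ne_top hp),
      one_div]
  rw [hsub, hconj] at hpow
  obtain ⟨M, hM⟩ := hσ.upper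
  refine hpow.of_le_mul (c := M) ?_ (ae_of_all _ fun x => ?_)
  · exact (hσ.measurable.aemeasurable.mul
      (hG.1.norm.aemeasurable.pow_const _)).aestronglyMeasurable.smul hG.1
  · rw [norm_smul, Real.norm_of_nonneg (mul_nonneg (hσ.pos x).le (by positivity)), mul_assoc,
      rpow_sub_two_mul_self hP.ne' (norm_nonneg _), Real.norm_of_nonneg (by positivity)]
    gcongr
    exact hM x

theorem integrable_flux (hp₁ : 1 < p) (hp : p ≠ ⊤) (hσ : IsElliptic σ) {G H : α → E}
    (hG : MemLp G p μ) (hH : MemLp H p μ) :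
    Integrable (fun x => σ x * ‖G x‖ ^ (p.toReal - 2) * inner ℝ (G x) (H x)) μ := by
  have : Fact (1 ≤ p) := ⟨hp₁.le⟩
  have : ENNReal.HolderTriple (ENNReal.conjExponent p) p 1 :=
    (inferInstance : ENNReal.HolderConjugate p (ENNReal.conjExponent p)).symm
  have hbilin := (innerSL ℝ).memLp_of_bilin 1 (memLp_flux hp₁ hp hσ hG) hH
  refine (memLp_one_iff_integrable.1 hbilin).congr (ae_of_all _ fun x => ?_)
  simp only
  rw [innerSL_apply_apply, real_inner_smul_left]

/-- `lpFlux σ G` as a bounded linear functional on `L^p`. -/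
def lpFluxCLM [Fact (1 ≤ p)] (hp₁ : 1 < p) (hp : p ≠ ⊤) (hσ : IsElliptic σ) (G : Lp E p μ) :
    StrongDual ℝ (Lp E p μ) :=
  have : ENNReal.HolderConjugate (ENNReal.conjExponent p) p :=
    (inferInstance : ENNReal.HolderConjugate p (ENNReal.conjExponent p)).symm
  have : Fact (1 ≤ ENNReal.conjExponent p) := ⟨by simp [ENNReal.conjExponent]⟩
  (innerSL ℝ : E →L[ℝ] E →L[ℝ] ℝ).lpPairing μ (ENNReal.conjExponent p) p
    ((memLp_flux hp₁ hp hσ (Lp.memLp G)).toLp _)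

theorem lpFluxCLM_apply [Fact (1 ≤ p)] (hp₁ : 1 < p) (hp : p ≠ ⊤) (hσ : IsElliptic σ)
    (G H : Lp E p μ) : lpFluxCLM hp₁ hp hσ G H = lpFlux σ G H := by
  rw [lpFluxCLM, ContinuousLinearMap.lpPairing_eq_integral, lpFlux]
  refine integral_congr_ae ?_
  filter_upwards [(memLp_flux hp₁ hp hσ (Lp.memLp G)).coeFn_toLp] with x hx
  rw [hx, innerSL_apply_apply, real_inner_smul_left]

theorem lpFlux_smul_right (G H : Lp E p μ) (t : ℝ) : lpFlux σ G (t • H) = t * lpFlux σ G H := by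
  rw [lpFlux, lpFlux, ← integral_const_mul]
  refine integral_congr_ae ?_
  filter_upwards [Lp.coeFn_smul t H] with x hx
  rw [hx, Pi.smul_apply, real_inner_smul_right]
  ring

theorem lpFlux_self (hp₀ : p ≠ 0) (hp : p ≠ ⊤) (G : Lp E p μ) :
    lpFlux σ G G = lpEnergy σ G := by
  simp only [lpFlux, lpEnergy, mul_assoc,
    norm_rpow_sub_two_mul_inner_self (ENNReal.toReal_ne_zero.2 ⟨hp₀, hp⟩)]

theorem lpEnergy_le_add_lpFlux (hp₁ : 1 < p) (hp : p ≠ ⊤) (hσ : IsElliptic σ)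
    (G H : Lp E p μ) :
    lpEnergy σ G ≤ lpEnergy σ H + p.toReal * lpFlux σ G (G - H) := by
  have hp₀ := (zero_lt_one.trans hp₁).ne'
  have hH := integrable_lpEnergy hp₀ hp hσ H
  have hflux := (integrable_flux hp₁ hp hσ (Lp.memLp G) (Lp.memLp (G - H))).const_mul p.toReal
  rw [lpEnergy, lpEnergy, lpFlux, ← integral_const_mul, ← integral_add hH hflux]
  refine integral_mono_ae (integrable_lpEnergy hp₀ hp hσ G) (hH.add hflux) ?_
  filter_upwards [Lp.coeFn_sub G H] with x hx
  have := mul_le_mul_of_nonneg_left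
    (norm_rpow_le_norm_rpow_add (one_lt_toReal hp₁ hp) (G x) (H x)) (hσ.pos x).le
  rw [hx, Pi.sub_apply]
  linarith

theorem lowerSemicontinuous_lpEnergy [Fact (1 ≤ p)] (hp₁ : 1 < p) (hp : p ≠ ⊤)
    (hσ : IsElliptic σ) : LowerSemicontinuous (lpEnergy σ : Lp E p μ → ℝ) := by
  intro G c hc
  have hlim : Tendsto (fun H => p.toReal * lpFluxCLM hp₁ hp hσ G (G - H)) (𝓝 G) (𝓝 0) := by
    have hcont : Continuous fun H => p.toReal * lpFluxCLM hp₁ hp hσ G (G - H) := by fun_prop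
    simpa using hcont.tendsto G
  filter_upwards [hlim.eventually_lt_const (sub_pos.2 hc)] with H hH
  rw [lpFluxCLM_apply] at hH
  linarith [lpEnergy_le_add_lpFlux hp₁ hp hσ G H]

theorem abs_norm_rpow_mul_inner_add_smul_le {P : ℝ} (hP : 1 < P) {t : ℝ} (ht : |t| ≤ 1) (a b : E) :
    |‖a + t • b‖ ^ (P - 2) * inner ℝ (a + t • b) b| ≤ (‖a‖ + ‖b‖) ^ P := by
  have : 0 ≤ P - 1 := by linarith
  have hnorm : ‖a + t • b‖ ≤ ‖a‖ + ‖b‖ := by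
    refine (norm_add_le _ _).trans ?_
    rw [norm_smul, Real.norm_eq_abs]
    gcongr
    exact mul_le_of_le_one_left (norm_nonneg b) ht
  calc _ ≤ ‖a + t • b‖ ^ (P - 1) * ‖b‖ := abs_norm_rpow_mul_inner_le hP.ne' _ _
    _ ≤ (‖a‖ + ‖b‖) ^ (P - 1) * (‖a‖ + ‖b‖) := by
      gcongr
      exact le_add_of_nonneg_left (norm_nonneg a)
    _ = (‖a‖ + ‖b‖) ^ P := by
      rw [← Real.rpow_add_one' (by positivity) (by linarith), sub_add_cancel]

theorem tendsto_lpFlux_add_smul (hp₁ : 1 < p) (hp : p ≠ ⊤) (hσ : IsElliptic σ)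
    (G H : Lp E p μ) :
    Tendsto (fun t : ℝ => lpFlux σ (G + t • H) H) (𝓝 0) (𝓝 (lpFlux σ G H)) := by
  have hP := one_lt_toReal hp₁ hp
  let F : ℝ → α → ℝ := fun t x =>
    σ x * inner ℝ (‖G x + t • H x‖ ^ (p.toReal - 2) • (G x + t • H x)) (H x)
  have hF : ∀ t : ℝ, lpFlux σ (G + t • H) H = ∫ x, F t x ∂μ := fun t => by
    refine integral_congr_ae ?_
    filter_upwards [Lp.coeFn_add G (t • H), Lp.coeFn_smul t H] with x hadd hsmul
    simp only [F, hadd, Pi.add_apply, hsmul, Pi.smul_apply, real_inner_smul_left, mul_assoc]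
  have hF_zero : lpFlux σ G H = ∫ x, F 0 x ∂μ := by rw [← hF, zero_smul, add_zero]
  simp only [hF, hF_zero]
  obtain ⟨M, hM⟩ := hσ.upper
  refine tendsto_integral_filter_of_dominated_convergence
    (fun x => M * (‖G x‖ + ‖H x‖) ^ p.toReal) (Eventually.of_forall fun t => ?_) ?_ ?_
    (ae_of_all _ fun x => ?_)
  · exact hσ.measurable.aestronglyMeasurable.mul
      (((continuous_norm_rpow_smul hP).comp_aestronglyMeasurable ((Lp.aestronglyMeasurable G).add
        ((Lp.aestronglyMeasurable H).const_smul t))).inner (Lp.aestronglyMeasurable H))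
  · filter_upwards [Metric.ball_mem_nhds (0 : ℝ) one_pos] with t ht
    refine ae_of_all _ fun x => ?_
    simp only [F]
    rw [real_inner_smul_left, norm_mul, Real.norm_of_nonneg (hσ.pos x).le, Real.norm_eq_abs]
    exact mul_le_mul (hM x) (abs_norm_rpow_mul_inner_add_smul_le hP
      (mem_ball_zero_iff.1 ht).le (G x) (H x)) (abs_nonneg _) ((hσ.pos x).le.trans (hM x))
  · have hint := ((Lp.memLp G).norm.add (Lp.memLp H).norm).integrable_norm_rpow
      (zero_lt_one.trans hp₁).ne' hp
    refine (hint.const_mul M).congr (ae_of_all _ fun x => ?_)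
    simp only [Pi.add_apply]
    rw [Real.norm_of_nonneg (by positivity)]
  · have hcont : Continuous fun t : ℝ => F t x :=
      continuous_const.mul (((continuous_norm_rpow_smul hP).comp (by fun_prop)).inner
        continuous_const)
    exact hcont.tendsto 0

theorem lpFlux_nonneg_of_le (hp₁ : 1 < p) (hp : p ≠ ⊤) (hσ : IsElliptic σ) {G H : Lp E p μ}
    (hG : ∀ t : ℝ, 0 < t → lpEnergy σ G ≤ lpEnergy σ (G + t • H)) : 0 ≤ lpFlux σ G H := by
  refine ge_of_tendsto ((tendsto_lpFlux_add_smul hp₁ hp hσ G H).mono_left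
    (nhdsWithin_le_nhds (s := Set.Ioi 0))) ?_
  filter_upwards [self_mem_nhdsWithin] with t (ht : 0 < t)
  have hslope := lpEnergy_le_add_lpFlux hp₁ hp hσ (G + t • H) G
  rw [add_sub_cancel_left, lpFlux_smul_right] at hslope
  have hmul : 0 ≤ p.toReal * t * lpFlux σ (G + t • H) H := by linarith [hG t ht]
  exact nonneg_of_mul_nonneg_right hmul
    (mul_pos (zero_lt_one.trans (one_lt_toReal hp₁ hp)) ht)

theorem lpFlux_eq_zero_of_le (hp₁ : 1 < p) (hp : p ≠ ⊤) (hσ : IsElliptic σ) {G H : Lp E p μ}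
    (hG : ∀ t : ℝ, lpEnergy σ G ≤ lpEnergy σ (G + t • H)) : lpFlux σ G H = 0 := by
  refine le_antisymm ?_ (lpFlux_nonneg_of_le hp₁ hp hσ fun t _ => hG t)
  have hneg : 0 ≤ lpFlux σ G ((-1 : ℝ) • H) :=
    lpFlux_nonneg_of_le hp₁ hp hσ fun t _ => by simpa using hG (-t)
  rw [lpFlux_smul_right] at hneg
  linarith

end LpEnergy

section SmoothFunctions

theorem memLp_restrict_of_continuous {X F : Type*} [PseudoMetricSpace X] [ProperSpace X]
    [MeasurableSpace X] [OpensMeasurableSpace X] [NormedAddCommGroup F]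
    [SecondCountableTopologyEither X F] {μ : Measure X} [IsFiniteMeasureOnCompacts μ]
    {Ω : Set X} (hΩ : Bornology.IsBounded Ω) {p : ℝ≥0∞} {f : X → F} (hf : Continuous f) :
    MemLp f p (μ.restrict Ω) := by
  have hK := hΩ.isCompact_closure
  have : IsFiniteMeasure (μ.restrict (closure Ω)) := ⟨by simpa using hK.measure_lt_top⟩
  obtain ⟨C, hC⟩ := hK.exists_bound_of_continuousOn hf.continuousOn
  have hfK : MemLp f p (μ.restrict (closure Ω)) :=
    MemLp.of_bound hf.aestronglyMeasurable C <| by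
      filter_upwards [ae_restrict_mem isClosed_closure.measurableSet] with x hx using hC x hx
  exact hfK.mono_measure (Measure.restrict_mono subset_closure le_rfl)

theorem continuous_gradient {E : Type*} [NormedAddCommGroup E] [InnerProductSpace ℝ E]
    [CompleteSpace E] {h : E → ℝ} (hh : ContDiff ℝ 1 h) : Continuous (gradient h) :=
  (InnerProductSpace.toDual ℝ E).symm.continuous.comp (hh.continuous_fderiv one_ne_zero)

theorem norm_gradient {E : Type*} [NormedAddCommGroup E] [InnerProductSpace ℝ E]
    [CompleteSpace E] (h : E → ℝ) (x : E) : ‖gradient h x‖ = ‖fderiv ℝ h x‖ :=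
  LinearIsometryEquiv.norm_map _ _

theorem integral_fderiv_mul_eq_neg_of_hasCompactSupport {E : Type*} [NormedAddCommGroup E]
    [NormedSpace ℝ E] [FiniteDimensional ℝ E] [MeasurableSpace E] [BorelSpace E] {μ : Measure E}
    [μ.IsAddHaarMeasure] {φ h : E → ℝ} (hφ : ContDiff ℝ 1 φ) (hφc : HasCompactSupport φ)
    (hh : ContDiff ℝ 1 h) (e : E) :
    ∫ x, fderiv ℝ φ x e * h x ∂μ = -∫ x, φ x * fderiv ℝ h x e ∂μ := by
  have hφe : Continuous fun x => fderiv ℝ φ x e := by fun_prop (disch := simp)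
  have hhe : Continuous fun x => fderiv ℝ h x e := by fun_prop (disch := simp)
  rw [integral_mul_fderiv_eq_neg_fderiv_mul_of_integrable, neg_neg]
  · exact (hφe.mul hh.continuous).integrable_of_hasCompactSupport
      (hφc.fderiv_apply ℝ e).mul_right
  · exact (hφ.continuous.mul hhe).integrable_of_hasCompactSupport hφc.mul_right
  · exact (hφ.continuous.mul hh.continuous).integrable_of_hasCompactSupport hφc.mul_right
  · exact fun x _ => hφ.differentiable one_ne_zero x
  · exact fun x _ => hh.differentiable one_ne_zero x

end SmoothFunctions

section TestFunctions

variable {d : ℕ} {Ω : Set (Space d)} {φ ψ : Space d → ℝ}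

theorem isTestFunction_zero : IsTestFunction Ω (0 : Space d → ℝ) :=
  ⟨contDiff_const, HasCompactSupport.zero, by simp [tsupport]⟩

theorem IsTestFunction.add (hφ : IsTestFunction Ω φ) (hψ : IsTestFunction Ω ψ) :
    IsTestFunction Ω (φ + ψ) :=
  ⟨hφ.smooth.add hψ.smooth, hφ.compact.add hψ.compact,
    (tsupport_add φ ψ).trans (Set.union_subset hφ.support hψ.support)⟩

theorem IsTestFunction.const_smul (hφ : IsTestFunction Ω φ) (c : ℝ) :
    IsTestFunction Ω (c • φ) :=
  ⟨hφ.smooth.const_smul c, hφ.compact.smul_left (f := fun _ => c),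
    (tsupport_smul_subset_right (fun _ => c) φ).trans hφ.support⟩

theorem IsTestFunction.eq_zero_of_notMem (hφ : IsTestFunction Ω φ) {x : Space d} (hx : x ∉ Ω) :
    φ x = 0 :=
  image_eq_zero_of_notMem_tsupport fun h => hx (hφ.support h)

theorem IsTestFunction.fderiv_eq_zero_of_notMem (hφ : IsTestFunction Ω φ) {x : Space d}
    (hx : x ∉ Ω) : fderiv ℝ φ x = 0 :=
  Function.notMem_support.1 fun h => hx (hφ.support (support_fderiv_subset ℝ h))

theorem IsTestFunction.contDiff_one (hφ : IsTestFunction Ω φ) : ContDiff ℝ 1 φ :=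
  hφ.smooth.of_le (by simp)

theorem IsTestFunction.setIntegral_fderiv_mul (hφ : IsTestFunction Ω φ) {h : Space d → ℝ}
    (hh : ContDiff ℝ 1 h) (e : Space d) :
    ∫ x in Ω, fderiv ℝ φ x e * h x = -∫ x in Ω, φ x * fderiv ℝ h x e := by
  rw [setIntegral_eq_integral_of_forall_compl_eq_zero,
    setIntegral_eq_integral_of_forall_compl_eq_zero]
  · exact integral_fderiv_mul_eq_neg_of_hasCompactSupport hφ.contDiff_one hφ.compact hh e
  · exact fun x hx => by simp [hφ.eq_zero_of_notMem hx]
  · exact fun x hx => by simp [hφ.fderiv_eq_zero_of_notMem hx]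

end TestFunctions

section WeakGradient

variable {d : ℕ} {Ω : Set (Space d)} {u v : Space d → ℝ} {G H : Space d → Space d}

theorem hasWeakGradient_gradient (hu : ContDiff ℝ 1 u) : HasWeakGradient Ω u (gradient u) :=
  fun φ hφ e => by
    simp only [inner_gradient_left]
    exact hφ.setIntegral_fderiv_mul hu e

theorem HasWeakGradient.congr (h : HasWeakGradient Ω u G) (huv : u =ᵐ[volume.restrict Ω] v)
    (hGH : G =ᵐ[volume.restrict Ω] H) : HasWeakGradient Ω v H := fun φ hφ e => by
  have hfun : ∫ x in Ω, fderiv ℝ φ x e * v x = ∫ x in Ω, fderiv ℝ φ x e * u x :=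
    integral_congr_ae (by filter_upwards [huv] with x hx; rw [hx])
  have hgrad : ∫ x in Ω, φ x * inner ℝ (H x) e = ∫ x in Ω, φ x * inner ℝ (G x) e :=
    integral_congr_ae (by filter_upwards [hGH] with x hx; rw [hx])
  rw [hfun, hgrad, h φ hφ e]

theorem HasWeakGradient.ae_eq_zero (hΩ : IsOpen Ω) (hG : LocallyIntegrable G (volume.restrict Ω))
    (h : HasWeakGradient Ω 0 G) : G =ᵐ[volume.restrict Ω] 0 := by
  have hpairing (φ : Space d → ℝ) (hφ : IsTestFunction Ω φ) : ∫ x in Ω, φ x • G x = 0 := by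
    refine ext_inner_left ℝ fun e => ?_
    have hφG : Integrable (fun x => φ x • G x) (volume.restrict Ω) :=
      hG.integrable_smul_left_of_hasCompactSupport hφ.smooth.continuous hφ.compact
    simpa [← integral_inner hφG, real_inner_smul_right, real_inner_comm] using (h φ hφ e).symm
  refine (ae_restrict_iff' hΩ.measurableSet).2 ?_
  refine hΩ.ae_eq_zero_of_integral_contDiff_smul_eq_zero
    (locallyIntegrableOn_of_locallyIntegrable_restrict hG) fun φ hφ hφc hφΩ => ?_
  have htest : IsTestFunction Ω φ := ⟨hφ, hφc, hφΩ⟩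
  rw [← setIntegral_eq_integral_of_forall_compl_eq_zero (s := Ω), hpairing φ htest]
  exact fun x hx => by simp [htest.eq_zero_of_notMem hx]

end WeakGradient

section Sobolev

variable {d : ℕ} {p : ℝ≥0∞} [Fact (1 ≤ p)] {Ω : Set (Space d)}

/-- The gradient as a continuous linear map on `W^{1,p}(Ω)`. -/
def gradL (p : ℝ≥0∞) [Fact (1 ≤ p)] (Ω : Set (Space d)) :
    sobolev p Ω →L[ℝ] Lp (Space d) p (volume.restrict Ω) :=
  (ContinuousLinearMap.snd ℝ _ _).comp (sobolev p Ω).subtypeL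

theorem exists_sobolev_of_contDiff (hΩ : Bornology.IsBounded Ω) {h : Space d → ℝ}
    (hh : ContDiff ℝ 1 h) :
    ∃ u : sobolev p Ω, toFun u =ᵐ[volume.restrict Ω] h ∧
      grad u =ᵐ[volume.restrict Ω] gradient h := by
  have hLp : MemLp h p (volume.restrict Ω) := memLp_restrict_of_continuous hΩ hh.continuous
  have hLp_grad : MemLp (gradient h) p (volume.restrict Ω) :=
    memLp_restrict_of_continuous hΩ (continuous_gradient hh)
  exact ⟨⟨(hLp.toLp h, hLp_grad.toLp _),
      (hasWeakGradient_gradient hh).congr hLp.coeFn_toLp.symm hLp_grad.coeFn_toLp.symm⟩,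
    hLp.coeFn_toLp, hLp_grad.coeFn_toLp⟩

theorem grad_eq_of_toFun_eq (hΩ : IsOpen Ω) {u v : sobolev p Ω} (h : toFun u = toFun v) :
    grad u = grad v := by
  have hzero : toFun (u - v) = 0 := sub_eq_zero.2 h
  have hweak : HasWeakGradient Ω 0 (grad (u - v)) :=
    HasWeakGradient.congr (u - v).2
      ((Lp.eq_zero_iff_ae_eq_zero (f := toFun (u - v))).1 hzero) EventuallyEq.rfl
  have hgrad : grad (u - v) = 0 := Lp.eq_zero_iff_ae_eq_zero.2 <|
    hweak.ae_eq_zero hΩ ((Lp.memLp _).locallyIntegrable Fact.out)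
  exact sub_eq_zero.1 hgrad

theorem grad_ae_eq_gradient (hΩo : IsOpen Ω) (hΩ : Bornology.IsBounded Ω) {u : sobolev p Ω}
    {h : Space d → ℝ} (hh : ContDiff ℝ 1 h) (hu : toFun u =ᵐ[volume.restrict Ω] h) :
    grad u =ᵐ[volume.restrict Ω] gradient h := by
  obtain ⟨v, hv, hv_grad⟩ := exists_sobolev_of_contDiff (p := p) hΩ hh
  rwa [grad_eq_of_toFun_eq hΩo (Lp.ext (hu.trans hv.symm))]

theorem exists_traceOf_eq (hΩo : IsOpen Ω) (hΩ : Bornology.IsBounded Ω) {h : Space d → ℝ}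
    (hh : ContDiff ℝ 1 h) :
    ∃ u : sobolev p Ω, traceOf p Ω h = trace u ∧ grad u =ᵐ[volume.restrict Ω] gradient h := by
  have hex : ∃ u : sobolev p Ω, toFun u =ᵐ[volume.restrict Ω] h :=
    (exists_sobolev_of_contDiff hΩ hh).imp fun _ hu => hu.1
  exact ⟨hex.choose, dif_pos hex, grad_ae_eq_gradient hΩo hΩ hh hex.choose_spec⟩

theorem continuous_integral_bilin {X E F : Type*} [MeasurableSpace X] {μ : Measure X}
    [NormedAddCommGroup E] [NormedSpace ℝ E] [NormedAddCommGroup F] [NormedSpace ℝ F]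
    (B : E →L[ℝ] F →L[ℝ] ℝ) {g : X → E} (hg : MemLp g (ENNReal.conjExponent p) μ) :
    Continuous fun f : Lp F p μ => ∫ x, B (g x) (f x) ∂μ := by
  have hpq : ENNReal.HolderConjugate (ENNReal.conjExponent p) p :=
    (inferInstance : ENNReal.HolderConjugate p (ENNReal.conjExponent p)).symm
  have : Fact (1 ≤ ENNReal.conjExponent p) := ⟨by simp [ENNReal.conjExponent]⟩
  have heq (f : Lp F p μ) : ∫ x, B (g x) (f x) ∂μ =
      B.lpPairing μ (ENNReal.conjExponent p) p (hg.toLp g) f := by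
    rw [ContinuousLinearMap.lpPairing_eq_integral]
    refine integral_congr_ae ?_
    filter_upwards [hg.coeFn_toLp] with x hx
    rw [hx]
  simp only [heq]
  fun_prop

theorem IsTestFunction.continuous_integral_fderiv_mul {φ : Space d → ℝ} (hφ : IsTestFunction Ω φ)
    (e : Space d) :
    Continuous fun f : Lp ℝ p (volume.restrict Ω) => ∫ x in Ω, fderiv ℝ φ x e * f x := by
  have hφe : Continuous fun x => fderiv ℝ φ x e := by
    have := hφ.contDiff_one
    fun_prop (disch := simp)
  exact continuous_integral_bilin (ContinuousLinearMap.mul ℝ ℝ)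
    (hφe.memLp_of_hasCompactSupport (hφ.compact.fderiv_apply ℝ e))

theorem IsTestFunction.continuous_integral_mul_inner {φ : Space d → ℝ} (hφ : IsTestFunction Ω φ)
    (e : Space d) :
    Continuous fun G : Lp (Space d) p (volume.restrict Ω) =>
      ∫ x in Ω, φ x * inner ℝ (G x) e := by
  have hφe : MemLp (fun x => φ x • e) (ENNReal.conjExponent p) (volume.restrict Ω) :=
    (hφ.smooth.continuous.smul continuous_const).memLp_of_hasCompactSupport
      hφ.compact.smul_right
  have hinner (x y : Space d) : φ x * inner ℝ y e = innerSL ℝ (φ x • e) y := by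
    rw [innerSL_apply_apply, real_inner_smul_left, real_inner_comm]
  simp only [hinner]
  exact continuous_integral_bilin (innerSL ℝ) hφe

theorem isClosed_sobolev : IsClosed (sobolev p Ω : Set
    (Lp ℝ p (volume.restrict Ω) × Lp (Space d) p (volume.restrict Ω))) := by
  change IsClosed {f : Lp ℝ p (volume.restrict Ω) × Lp (Space d) p (volume.restrict Ω) |
    HasWeakGradient Ω f.1 f.2}
  simp only [HasWeakGradient, Set.ofPred_forall]
  exact isClosed_iInter fun φ => isClosed_iInter fun hφ => isClosed_iInter fun e =>
    isClosed_eq ((hφ.continuous_integral_fderiv_mul e).comp continuous_fst)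
      ((hφ.continuous_integral_mul_inner e).comp continuous_snd).neg

instance : CompleteSpace (sobolev p Ω) := isClosed_sobolev.completeSpace_coe

theorem isClosed_sobolevZero : IsClosed (sobolevZero p Ω : Set (sobolev p Ω)) :=
  Submodule.isClosed_topologicalClosure _

theorem sobolevZero_induction {C : Set (sobolev p Ω)} (hC : IsClosed C)
    (h : ∀ (u : sobolev p Ω) (φ : Space d → ℝ), IsTestFunction Ω φ →
      toFun u =ᵐ[volume.restrict Ω] φ → u ∈ C)
    {u : sobolev p Ω} (hu : u ∈ sobolevZero p Ω) : u ∈ C := by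
  refine closure_minimal (fun v hv => ?_) hC hu
  suffices ∃ φ, IsTestFunction Ω φ ∧ toFun v =ᵐ[volume.restrict Ω] φ by
    obtain ⟨φ, hφ, hvφ⟩ := this
    exact h v φ hφ hvφ
  induction hv using Submodule.span_induction with
  | mem _ hv => exact hv
  | zero => exact ⟨0, isTestFunction_zero, Lp.coeFn_zero ℝ p (volume.restrict Ω)⟩
  | add v w _ _ hv hw =>
    obtain ⟨φ, hφ, hvφ⟩ := hv
    obtain ⟨ψ, hψ, hwψ⟩ := hw
    exact ⟨φ + ψ, hφ.add hψ, (Lp.coeFn_add (toFun v) (toFun w)).trans (hvφ.add hwψ)⟩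
  | smul c v _ hv =>
    obtain ⟨φ, hφ, hvφ⟩ := hv
    exact ⟨c • φ, hφ.const_smul c, (Lp.coeFn_smul c (toFun v)).trans (hvφ.const_smul c)⟩

end Sobolev

section Poincare

theorem isClosed_map_of_norm_le {V W : Type*} [NormedAddCommGroup V] [NormedSpace ℝ V]
    [CompleteSpace V] [NormedAddCommGroup W] [NormedSpace ℝ W] {S : Submodule ℝ V}
    (hS : IsClosed (S : Set V)) (T : V →L[ℝ] W) {C : ℝ≥0} (hC : ∀ v ∈ S, ‖v‖ ≤ C * ‖T v‖) :
    IsClosed (S.map T.toLinearMap : Set W) := by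
  have : CompleteSpace S := hS.completeSpace_coe
  have hT : AntilipschitzWith C (T.comp S.subtypeL) :=
    ContinuousLinearMap.antilipschitz_of_bound _ fun v => hC v.1 v.2
  convert hT.isClosed_range (T.comp S.subtypeL).uniformContinuous using 1
  ext w
  simp

theorem exists_sobolev_exponent {n : ℕ} (hn : 1 < n) {p : ℝ≥0} (hp : 1 ≤ p) :
    ∃ r : ℝ≥0, 1 ≤ r ∧ r < n ∧ r ≤ p ∧ (r : ℝ)⁻¹ - (n : ℝ)⁻¹ ≤ (p : ℝ)⁻¹ := by
  have hp₀ : 0 < p := zero_lt_one.trans_le hp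
  have hn₀ : (0 : ℝ≥0) < n := by exact_mod_cast zero_lt_one.trans hn
  refine ⟨max 1 (p⁻¹ + (n : ℝ≥0)⁻¹)⁻¹, le_max_left _ _, max_lt (by exact_mod_cast hn) ?_,
    max_le hp ?_, ?_⟩
  · exact inv_lt_of_inv_lt₀ hn₀ (lt_add_of_pos_left _ (inv_pos.2 hp₀))
  · exact inv_le_of_inv_le₀ hp₀ le_self_add
  · rw [sub_le_iff_le_add]
    have hr : (max 1 (p⁻¹ + (n : ℝ≥0)⁻¹)⁻¹)⁻¹ ≤ p⁻¹ + (n : ℝ≥0)⁻¹ :=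
      inv_le_of_inv_le₀ (by positivity) (le_max_right _ _)
    exact_mod_cast hr

theorem eLpNorm_le_mul_eLpNorm_of_support_subset {X F : Type*} [MeasurableSpace X]
    [NormedAddCommGroup F] {μ : Measure X} {s : Set X} {f : X → F}
    (hf : AEStronglyMeasurable f μ) (hfs : f.support ⊆ s) {r p : ℝ≥0∞} (hrp : r ≤ p) :
    eLpNorm f r μ ≤ eLpNorm f p μ * μ s ^ (1 / r.toReal - 1 / p.toReal) := by
  simpa only [eLpNorm_restrict_eq_of_support_subset hfs, Measure.restrict_apply_univ] using
    eLpNorm_le_eLpNorm_mul_rpow_measure_univ hrp (hf.restrict (s := s))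

theorem exists_eLpNorm_le_mul_eLpNorm_fderiv {E F : Type*} [NormedAddCommGroup E]
    [NormedSpace ℝ E] [FiniteDimensional ℝ E] [MeasurableSpace E] [BorelSpace E]
    [NormedAddCommGroup F] [NormedSpace ℝ F] [FiniteDimensional ℝ F] (μ : Measure E)
    [μ.IsAddHaarMeasure] (hE : 1 < Module.finrank ℝ E) {s : Set E} (hs : Bornology.IsBounded s)
    {p : ℝ≥0} (hp : 1 ≤ p) :
    ∃ C : ℝ≥0, ∀ u : E → F, ContDiff ℝ 1 u → u.support ⊆ s →
      eLpNorm u p μ ≤ C * eLpNorm (fderiv ℝ u) p μ := by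
  obtain ⟨r, hr, hrE, hrp, hrp'⟩ := exists_sobolev_exponent hE hp
  have hvol : μ (closure s) ^ (1 / r - 1 / p : ℝ) ≠ ⊤ :=
    ENNReal.rpow_ne_top_of_nonneg
      (sub_nonneg.2 (one_div_le_one_div_of_le (by positivity) (by exact_mod_cast hrp)))
      hs.isCompact_closure.measure_lt_top.ne
  refine ⟨eLpNormLESNormFDerivOfLeConst F μ s r p *
    (μ (closure s) ^ (1 / r - 1 / p : ℝ)).toNNReal, fun u hu hus => ?_⟩
  have hsupp : (fderiv ℝ u).support ⊆ closure s :=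
    (support_fderiv_subset ℝ).trans (closure_mono hus)
  have hmeas : AEStronglyMeasurable (fderiv ℝ u) μ :=
    (hu.continuous_fderiv one_ne_zero).aestronglyMeasurable
  calc eLpNorm u p μ
    _ ≤ eLpNormLESNormFDerivOfLeConst F μ s r p * eLpNorm (fderiv ℝ u) r μ :=
      eLpNorm_le_eLpNorm_fderiv_of_le μ hu hus hr hrE hrp' hs
    _ ≤ eLpNormLESNormFDerivOfLeConst F μ s r p *
        (eLpNorm (fderiv ℝ u) p μ * μ (closure s) ^ (1 / r - 1 / p : ℝ)) := by
      gcongr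
      exact eLpNorm_le_mul_eLpNorm_of_support_subset hmeas hsupp (by exact_mod_cast hrp)
    _ = _ := by
      rw [ENNReal.coe_mul, ENNReal.coe_toNNReal hvol]
      ring

variable {d : ℕ} {p : ℝ≥0∞} [Fact (1 ≤ p)] {Ω : Set (Space d)}

theorem eLpNorm_restrict_gradient {φ : Space d → ℝ} (hφ : IsTestFunction Ω φ) (p : ℝ≥0∞) :
    eLpNorm (gradient φ) p (volume.restrict Ω) = eLpNorm (fderiv ℝ φ) p volume := by
  rw [eLpNorm_congr_norm_ae (ae_of_all _ (norm_gradient φ)),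
    eLpNorm_restrict_eq_of_support_subset ((support_fderiv_subset ℝ).trans hφ.support)]

theorem exists_norm_toFun_le_norm_grad (hd : 1 < d) (hp : p ≠ ⊤) (hΩo : IsOpen Ω)
    (hΩ : Bornology.IsBounded Ω) :
    ∃ C : ℝ≥0, ∀ u ∈ sobolevZero p Ω, ‖toFun u‖ ≤ C * ‖grad u‖ := by
  lift p to ℝ≥0 using hp
  obtain ⟨C, hC⟩ := exists_eLpNorm_le_mul_eLpNorm_fderiv (F := ℝ) (volume : Measure (Space d))
    (by simpa using hd) hΩ (p := p) (by exact_mod_cast (Fact.out : 1 ≤ (p : ℝ≥0∞)))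
  refine ⟨C, fun u hu => ?_⟩
  have hclosed : IsClosed {u : sobolev (p : ℝ≥0∞) Ω | ‖toFun u‖ ≤ C * ‖grad u‖} :=
    isClosed_le (continuous_fst.comp continuous_subtype_val).norm
      (continuous_const.mul (gradL _ Ω).continuous.norm)
  refine sobolevZero_induction hclosed (fun v φ hφ hv => ?_) hu
  have hle : eLpNorm φ p (volume.restrict Ω) ≤
      C * eLpNorm (gradient φ) p (volume.restrict Ω) := by
    have hsupp : φ.support ⊆ Ω := (subset_tsupport φ).trans hφ.support
    rw [eLpNorm_restrict_gradient hφ, eLpNorm_restrict_eq_of_support_subset hsupp]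
    exact hC φ hφ.contDiff_one hsupp
  rw [Set.mem_ofPred_eq, Lp.norm_def, Lp.norm_def, eLpNorm_congr_ae hv, ← ENNReal.coe_toReal C,
    ← ENNReal.toReal_mul, eLpNorm_congr_ae (grad_ae_eq_gradient hΩo hΩ hφ.contDiff_one hv)]
  refine ENNReal.toReal_mono (ENNReal.mul_ne_top ENNReal.coe_ne_top ?_) hle
  exact (memLp_restrict_of_continuous hΩ (continuous_gradient hφ.contDiff_one)).eLpNorm_ne_top

theorem isClosed_map_gradL (hd : 1 < d) (hp : p ≠ ⊤) (hΩo : IsOpen Ω)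
    (hΩ : Bornology.IsBounded Ω) :
    IsClosed ((sobolevZero p Ω).map (gradL p Ω).toLinearMap :
      Set (Lp (Space d) p (volume.restrict Ω))) := by
  obtain ⟨C, hC⟩ := exists_norm_toFun_le_norm_grad (p := p) hd hp hΩo hΩ
  refine isClosed_map_of_norm_le (V := sobolev p Ω) (C := max C 1) isClosed_sobolevZero
    (gradL p Ω) fun u hu => max_le ?_ ?_
  · exact (hC u hu).trans (mul_le_mul_of_nonneg_right (le_max_left _ _) (norm_nonneg _))
  · exact le_mul_of_one_le_left (norm_nonneg _) (le_max_right _ _)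

end Poincare

section DNMap

theorem exists_lpEnergy_add_le {α E : Type*} [MeasurableSpace α] {μ : Measure α}
    [NormedAddCommGroup E] [InnerProductSpace ℝ E] [FiniteDimensional ℝ E] {p : ℝ≥0∞}
    [Fact (1 ≤ p)] {σ : α → ℝ} (hp₁ : 1 < p) (hp : p ≠ ⊤) (hσ : IsElliptic σ)
    {K : Submodule ℝ (Lp E p μ)} (hK : IsClosed (K : Set (Lp E p μ))) (G : Lp E p μ) :
    ∃ H ∈ K, ∀ H' ∈ K, lpEnergy σ (G + H) ≤ lpEnergy σ (G + H') := by
  have hP := one_lt_toReal hp₁ hp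
  have hE : UniformMidpointConvex p.toReal fun x : E => ‖x‖ ^ p.toReal :=
    uniformMidpointConvex_norm_rpow hP
  have hconv : Convex ℝ ((G + ·) '' (K : Set (Lp E p μ))) := (Submodule.convex K).translate G
  have hclosed : IsClosed ((G + ·) '' (K : Set (Lp E p μ))) :=
    (Homeomorph.addLeft G).isClosedMap _ hK
  have hbdd : BddBelow (lpEnergy σ '' ((G + ·) '' (K : Set (Lp E p μ)))) :=
    ⟨0, by rintro _ ⟨F, -, rfl⟩; exact lpEnergy_nonneg hσ F⟩
  obtain ⟨_, ⟨H, hH, rfl⟩, hmin⟩ := (hE.lpEnergy hp hσ).exists_isMinOn (zero_lt_one.trans hP)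
    (lowerSemicontinuous_lpEnergy hp₁ hp hσ) hconv hclosed ⟨G + 0, 0, K.zero_mem, rfl⟩ hbdd
  exact ⟨H, hH, fun H' hH' => hmin ⟨H', hH', rfl⟩⟩

variable {d : ℕ} {Ω : Set (Space d)} {p : ℝ≥0∞} [Fact (1 ≤ p)] {σ : Space d → ℝ}

theorem trace_eq_iff {u v : sobolev p Ω} : trace u = trace v ↔ u - v ∈ sobolevZero p Ω :=
  Submodule.Quotient.eq _

theorem exists_isMinimizer (hd : 1 < d) (hp₁ : 1 < p) (hp : p ≠ ⊤) (hΩo : IsOpen Ω)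
    (hΩ : Bornology.IsBounded Ω) (hσ : IsElliptic σ) (f : BoundaryValues p Ω) :
    ∃ u : sobolev p Ω, trace u = f ∧ IsMinimizer σ u := by
  obtain ⟨u, rfl⟩ := (sobolevZero p Ω).mkQ_surjective f
  obtain ⟨_, ⟨h, hh, rfl⟩, hmin⟩ :=
    exists_lpEnergy_add_le hp₁ hp hσ (isClosed_map_gradL hd hp hΩo hΩ) (grad u)
  have htrace : trace (u + h) = trace u := trace_eq_iff.2 (by simpa using hh)
  refine ⟨u + h, htrace, fun v hv => ?_⟩
  have hmin_v := hmin _ ⟨v - u, trace_eq_iff.1 (hv.trans htrace), rfl⟩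
  have hgrad : grad u + gradL p Ω (v - u) = grad v := add_sub_cancel (grad u) (grad v)
  exact hmin_v.trans_eq (congrArg (lpEnergy σ) hgrad)

theorem IsMinimizer.fluxPairing_eq_zero (hp₁ : 1 < p) (hp : p ≠ ⊤) (hσ : IsElliptic σ)
    {u v : sobolev p Ω} (hu : IsMinimizer σ u) (hv : v ∈ sobolevZero p Ω) :
    fluxPairing σ u v = 0 :=
  lpFlux_eq_zero_of_le hp₁ hp hσ fun t =>
    hu (u + t • v) (trace_eq_iff.2 (by simpa using Submodule.smul_mem _ t hv))

theorem isMinimizer_of_fluxPairing_eq_zero (hp₁ : 1 < p) (hp : p ≠ ⊤) (hσ : IsElliptic σ)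
    {u : sobolev p Ω} (hu : ∀ v ∈ sobolevZero p Ω, fluxPairing σ u v = 0) :
    IsMinimizer σ u := fun v hv => by
  have hconv := lpEnergy_le_add_lpFlux hp₁ hp hσ (grad u) (grad v)
  have hflux : lpFlux σ (grad u) (grad u - grad v) = 0 := hu (u - v) (trace_eq_iff.1 hv.symm)
  rwa [hflux, mul_zero, add_zero] at hconv

theorem trace_midpoint {u v : sobolev p Ω} (h : trace u = trace v) :
    trace (midpoint ℝ u v) = trace u := by
  rw [trace_eq_iff, midpoint_sub_left]
  exact Submodule.smul_mem _ _ (trace_eq_iff.1 h.symm)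

theorem IsMinimizer.grad_eq (hp₁ : 1 < p) (hp : p ≠ ⊤) (hσ : IsElliptic σ)
    {u v : sobolev p Ω} (hu : IsMinimizer σ u) (hv : IsMinimizer σ v) (h : trace u = trace v) :
    grad u = grad v := by
  have hP := one_lt_toReal hp₁ hp
  have hE : UniformMidpointConvex p.toReal fun x : Space d => ‖x‖ ^ p.toReal :=
    uniformMidpointConvex_norm_rpow hP
  have hmid : grad (midpoint ℝ u v) = midpoint ℝ (grad u) (grad v) := by
    simp only [midpoint_eq_smul_add]
    rfl
  refine (hE.lpEnergy hp hσ).eq_of_le_midpoint (zero_lt_one.trans hP).ne' ?_ ?_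
  · exact (hu _ (trace_midpoint h)).trans_eq (congrArg (lpEnergy σ) hmid)
  · exact (hv _ ((trace_midpoint h).trans h)).trans_eq (congrArg (lpEnergy σ) hmid)

theorem fluxPairing_add_right (hp₁ : 1 < p) (hp : p ≠ ⊤) (hσ : IsElliptic σ)
    (u v w : sobolev p Ω) :
    fluxPairing σ u (v + w) = fluxPairing σ u v + fluxPairing σ u w := by
  have hadd := map_add (lpFluxCLM hp₁ hp hσ (grad u)) (grad v) (grad w)
  simp only [lpFluxCLM_apply] at hadd
  exact hadd

theorem exists_isDNMap (hd : 1 < d) (hp₁ : 1 < p) (hp : p ≠ ⊤) (hΩo : IsOpen Ω)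
    (hΩ : Bornology.IsBounded Ω) (hσ : IsElliptic σ) :
    ∃ Λ : BoundaryValues p Ω → StrongDual ℝ (BoundaryValues p Ω), IsDNMap σ Λ := by
  choose U hU hUmin using exists_isMinimizer (p := p) hd hp₁ hp hΩo hΩ hσ
  let L (f : BoundaryValues p Ω) : StrongDual ℝ (sobolev p Ω) :=
    (lpFluxCLM hp₁ hp hσ (grad (U f))).comp (gradL p Ω)
  have hL (f : BoundaryValues p Ω) (v : sobolev p Ω) : L f v = fluxPairing σ (U f) v :=
    lpFluxCLM_apply hp₁ hp hσ _ _
  have hker (f : BoundaryValues p Ω) : sobolevZero p Ω ≤ (L f).ker := fun v hv =>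
    (hL f v).trans ((hUmin f).fluxPairing_eq_zero hp₁ hp hσ hv)
  refine ⟨fun f => (sobolevZero p Ω).liftQL (L f) (hker f), fun f => ⟨U f, hU f, hUmin f⟩,
    fun u v hu => ?_⟩
  have hgrad : grad (U (trace u)) = grad u := (hUmin _).grad_eq hp₁ hp hσ hu (hU _)
  exact (hL (trace u) v).trans (congrArg (fun G => lpFlux σ G (grad v)) hgrad)

theorem isDNMap_dnMap (hd : 1 < d) (hp₁ : 1 < p) (hp : p ≠ ⊤) (hΩo : IsOpen Ω)
    (hΩ : Bornology.IsBounded Ω) (hσ : IsElliptic σ) : IsDNMap σ (dnMap p Ω σ) := by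
  have hex := exists_isDNMap (p := p) hd hp₁ hp hΩo hΩ hσ
  rw [dnMap, dif_pos hex]
  exact hex.choose_spec

end DNMap

section Existence

variable {P : ℝ}

theorem wolffV_denominator_pos (hP : 1 < P) {a b : ℝ} (h : 0 < a ^ 2 + b ^ 2) :
    0 < (P - 1) * b ^ 2 + a ^ 2 := by
  have hP₀ : 0 < P - 1 := sub_pos.2 hP
  rcases eq_or_ne a 0 with rfl | ha
  · have hb : 0 < b ^ 2 := by simpa using h
    simpa using mul_pos hP₀ hb
  · positivity

theorem wolffV_mul_mul {r : ℝ} (hr : r ≠ 0) (a b : ℝ) :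
    wolffV P (r * a) (r * b) = wolffV P a b := by
  have hnum : (2 * P - 3) * (r * b) ^ 2 + (P - 1) * (r * a) ^ 2
      = r ^ 2 * ((2 * P - 3) * b ^ 2 + (P - 1) * a ^ 2) := by ring
  have hden : (P - 1) * (r * b) ^ 2 + (r * a) ^ 2 = r ^ 2 * ((P - 1) * b ^ 2 + a ^ 2) := by ring
  rw [wolffV, hnum, hden, mul_div_mul_left _ _ (pow_ne_zero 2 hr), wolffV]

/-- The denominator of `V(a, b)` at a point `(a, b) = (cos θ, sin θ)` of the unit circle. -/
def wolffDensity (P θ : ℝ) : ℝ := (P - 1) * Real.sin θ ^ 2 + Real.cos θ ^ 2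

/-- The primitive of `wolffDensity` that vanishes at zero. In polar coordinates
`(w, w') = R (cos θ, sin θ)`, the equation of a Wolff function says that
`wolffPhase P (θ s) + (P - 1) * s` is constant. -/
def wolffPhase (P θ : ℝ) : ℝ := P / 2 * θ + (2 - P) / 4 * Real.sin (2 * θ)

/-- The radius `R` of a Wolff function as a function of the angle `θ`, in polar coordinates
`(w, w') = R (cos θ, sin θ)`. -/
def wolffRadius (P θ : ℝ) : ℝ := Real.exp (-((2 - P) / (2 * (P - 1))) * Real.sin θ ^ 2)

theorem wolffDensity_pos (hP : 1 < P) (θ : ℝ) : 0 < wolffDensity P θ :=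
  wolffV_denominator_pos hP (by rw [Real.cos_sq_add_sin_sq]; exact one_pos)

theorem hasDerivAt_wolffPhase (P θ : ℝ) : HasDerivAt (wolffPhase P) (wolffDensity P θ) θ := by
  have hsin : HasDerivAt (fun θ : ℝ => Real.sin (2 * θ)) (Real.cos (2 * θ) * 2) θ := by
    simpa using ((hasDerivAt_id θ).const_mul (2 : ℝ)).sin
  refine (((hasDerivAt_id θ).const_mul (P / 2)).add
    (hsin.const_mul ((2 - P) / 4))).congr_deriv ?_
  rw [wolffDensity, Real.sin_sq, Real.cos_two_mul]
  ring

theorem contDiff_wolffPhase (P : ℝ) {n : WithTop ℕ∞} : ContDiff ℝ n (wolffPhase P) := by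
  unfold wolffPhase
  fun_prop

theorem strictMono_wolffPhase (hP : 1 < P) : StrictMono (wolffPhase P) :=
  strictMono_of_hasDerivAt_pos (hasDerivAt_wolffPhase P) (wolffDensity_pos hP)

theorem surjective_wolffPhase (hP : 0 < P) : Function.Surjective (wolffPhase P) := by
  have hbounded (θ : ℝ) : |(2 - P) / 4 * Real.sin (2 * θ)| ≤ |(2 - P) / 4| := by
    rw [abs_mul]
    exact mul_le_of_le_one_right (abs_nonneg _) (Real.abs_sin_le_one _)
  refine (contDiff_wolffPhase P (n := 0)).continuous.surjective ?_ ?_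
  · exact tendsto_atTop_add_right_of_le _ (-|(2 - P) / 4|)
      (tendsto_id.const_mul_atTop (half_pos hP)) fun θ => (abs_le.1 (hbounded θ)).1
  · exact tendsto_atBot_add_right_of_ge _ |(2 - P) / 4|
      (tendsto_id.const_mul_atBot (half_pos hP)) fun θ => (abs_le.1 (hbounded θ)).2

theorem exists_wolffAngle (hP : 1 < P) : ∃ θ : ℝ → ℝ, ContDiff ℝ ∞ θ ∧
    ∀ s, HasDerivAt θ (-(P - 1) / wolffDensity P (θ s)) s := by
  let Φ : ℝ ≃ₜ ℝ := ((strictMono_wolffPhase hP).orderIsoOfSurjective _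
    (surjective_wolffPhase (zero_lt_one.trans hP))).toHomeomorph
  have hΦ (θ : ℝ) : HasDerivAt Φ (wolffDensity P θ) θ := hasDerivAt_wolffPhase P θ
  have hsmooth : ContDiff ℝ ∞ Φ.symm :=
    Φ.contDiff_symm_deriv (fun θ => (wolffDensity_pos hP θ).ne') hΦ (contDiff_wolffPhase P)
  have hsymm (y : ℝ) : HasDerivAt Φ.symm (wolffDensity P (Φ.symm y))⁻¹ y :=
    HasDerivAt.of_local_left_inverse Φ.symm.continuous.continuousAt (hΦ _)
      (wolffDensity_pos hP _).ne' (Eventually.of_forall Φ.apply_symm_apply)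
  refine ⟨fun s => Φ.symm (-(P - 1) * s), hsmooth.comp (by fun_prop), fun s => ?_⟩
  have hlinear : HasDerivAt (fun s : ℝ => -(P - 1) * s) (-(P - 1)) s := by
    simpa using (hasDerivAt_id s).const_mul (-(P - 1))
  exact ((hsymm _).comp s hlinear).congr_deriv (div_eq_inv_mul _ _).symm

theorem hasDerivAt_wolffRadius (P θ : ℝ) : HasDerivAt (wolffRadius P)
    (-((2 - P) / (P - 1)) * Real.sin θ * Real.cos θ * wolffRadius P θ) θ := by
  refine (((Real.hasDerivAt_sin θ).pow 2).const_mul _).exp.congr_deriv ?_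
  rw [wolffRadius, mul_comm 2 (P - 1), ← div_div]
  simp only [Pi.pow_apply]
  push_cast
  ring

theorem hasDerivAt_wolffRadius_mul_cos (hP : 1 < P) (θ : ℝ) :
    HasDerivAt (fun θ => wolffRadius P θ * Real.cos θ)
      (-(wolffRadius P θ * Real.sin θ * (wolffDensity P θ / (P - 1)))) θ := by
  have hP₀ : P - 1 ≠ 0 := (sub_pos.2 hP).ne'
  refine ((hasDerivAt_wolffRadius P θ).mul (Real.hasDerivAt_cos θ)).congr_deriv ?_
  rw [wolffDensity, Real.sin_sq]
  field_simp
  rw [Real.cos_sq']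
  ring

theorem hasDerivAt_wolffRadius_mul_sin (hP : 1 < P) (θ : ℝ) :
    HasDerivAt (fun θ => wolffRadius P θ * Real.sin θ) (wolffRadius P θ * Real.cos θ *
      (wolffV P (Real.cos θ) (Real.sin θ) * (wolffDensity P θ / (P - 1)))) θ := by
  have hP₀ : P - 1 ≠ 0 := (sub_pos.2 hP).ne'
  have hcancel : wolffV P (Real.cos θ) (Real.sin θ) * (wolffDensity P θ / (P - 1))
      = ((2 * P - 3) * Real.sin θ ^ 2 + (P - 1) * Real.cos θ ^ 2) / (P - 1) :=
    div_mul_div_cancel₀ (wolffDensity_pos hP θ).ne'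
  refine ((hasDerivAt_wolffRadius P θ).mul (Real.hasDerivAt_sin θ)).congr_deriv ?_
  rw [hcancel]
  field_simp
  rw [Real.cos_sq']
  ring

theorem isWolffFunction_wolffRadius_mul_cos (hP : 1 < P) {θ : ℝ → ℝ} (hθ : ContDiff ℝ ∞ θ)
    (hθ' : ∀ s, HasDerivAt θ (-(P - 1) / wolffDensity P (θ s)) s) :
    IsWolffFunction P fun s => wolffRadius P (θ s) * Real.cos (θ s) := by
  have hP₀ : P - 1 ≠ 0 := (sub_pos.2 hP).ne'
  have hdensity (s : ℝ) : wolffDensity P (θ s) ≠ 0 := (wolffDensity_pos hP _).ne'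
  have hradius (s : ℝ) : wolffRadius P (θ s) ≠ 0 := (Real.exp_pos _).ne'
  have hderiv : deriv (fun s => wolffRadius P (θ s) * Real.cos (θ s))
      = fun s => wolffRadius P (θ s) * Real.sin (θ s) := funext fun s => by
    refine ((hasDerivAt_wolffRadius_mul_cos hP (θ s)).comp s (hθ' s)).deriv.trans ?_
    have := hdensity s
    field_simp
  refine ⟨?_, fun s => ?_, ?_⟩
  · unfold wolffRadius
    fun_prop
  · have hderiv₂ := ((hasDerivAt_wolffRadius_mul_sin hP (θ s)).comp s (hθ' s)).deriv
    rw [Function.comp_def] at hderiv₂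
    rw [hderiv, wolffV_mul_mul (hradius s), hderiv₂]
    have := hdensity s
    field_simp
    ring
  · rw [hderiv]
    by_contra! hzero
    have hcos : Real.cos (θ 0) = 0 := (mul_eq_zero.1 hzero.1).resolve_left (hradius 0)
    have hsin : Real.sin (θ 0) = 0 := (mul_eq_zero.1 hzero.2).resolve_left (hradius 0)
    simpa [hcos, hsin] using Real.sin_sq_add_cos_sq (θ 0)

theorem exists_isWolffFunction (hP : 1 < P) : ∃ w : ℝ → ℝ, IsWolffFunction P w :=
  let ⟨_, hθ, hθ'⟩ := exists_wolffAngle hP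
  ⟨_, isWolffFunction_wolffRadius_mul_cos hP hθ hθ'⟩

end Existence

section WolffFunction

theorem monotone_mul_exp_of_le_deriv {E E' : ℝ → ℝ} {c : ℝ} (hE : ∀ s, HasDerivAt E (E' s) s)
    (hc : ∀ s, -(c * E s) ≤ E' s) : Monotone fun s => E s * Real.exp (c * s) := by
  have hderiv (s : ℝ) : HasDerivAt (fun s => E s * Real.exp (c * s))
      ((E' s + c * E s) * Real.exp (c * s)) s := by
    have hlinear : HasDerivAt (fun s : ℝ => c * s) c s := by
      simpa using (hasDerivAt_id s).const_mul c
    exact ((hE s).mul hlinear.exp).congr_deriv (by ring)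
  exact monotone_of_hasDerivAt_nonneg hderiv fun s =>
    mul_nonneg (neg_le_iff_add_nonneg.1 (hc s)) (Real.exp_pos _).le

theorem pos_of_abs_deriv_le {E E' : ℝ → ℝ} {K s₀ : ℝ} (hE : ∀ s, HasDerivAt E (E' s) s)
    (hK : ∀ s, |E' s| ≤ K * E s) (h₀ : 0 < E s₀) (s : ℝ) : 0 < E s := by
  rcases le_total s₀ s with hs | hs
  · have hmono := monotone_mul_exp_of_le_deriv hE (fun s => neg_le_of_abs_le (hK s)) hs
    exact pos_of_mul_pos_left ((mul_pos h₀ (Real.exp_pos _)).trans_le hmono) (Real.exp_pos _).le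
  · have hE_neg (s : ℝ) : HasDerivAt (fun s => E (-s)) (-E' (-s)) s := by
      simpa [Function.comp_def] using (hE (-s)).scomp s (hasDerivAt_neg s)
    have hmono := monotone_mul_exp_of_le_deriv hE_neg
      (fun s => neg_le_neg ((le_abs_self _).trans (hK (-s)))) (neg_le_neg hs)
    simp only [neg_neg] at hmono
    exact pos_of_mul_pos_left ((mul_pos h₀ (Real.exp_pos _)).trans_le hmono) (Real.exp_pos _).le

variable {P : ℝ} {w : ℝ → ℝ}

theorem abs_wolffV_le (hP : 1 < P) (a b : ℝ) :
    |wolffV P a b| ≤ |2 * P - 3| / (P - 1) + (P - 1) := by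
  have hP₀ : 0 < P - 1 := sub_pos.2 hP
  have hden : 0 ≤ (P - 1) * b ^ 2 + a ^ 2 := by positivity
  rw [wolffV, abs_div, abs_of_nonneg hden]
  refine div_le_of_le_mul₀ hden (by positivity) ?_
  calc |(2 * P - 3) * b ^ 2 + (P - 1) * a ^ 2|
      ≤ |2 * P - 3| * b ^ 2 + (P - 1) * a ^ 2 := by
        refine (abs_add_le _ _).trans_eq ?_
        rw [abs_mul, abs_sq, abs_of_nonneg (mul_nonneg hP₀.le (sq_nonneg a))]
    _ = |2 * P - 3| / (P - 1) * ((P - 1) * b ^ 2) + (P - 1) * a ^ 2 := by field_simp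
    _ ≤ |2 * P - 3| / (P - 1) * ((P - 1) * b ^ 2 + a ^ 2)
        + (P - 1) * ((P - 1) * b ^ 2 + a ^ 2) := by
      gcongr
      · exact le_add_of_nonneg_right (sq_nonneg a)
      · exact le_add_of_nonneg_left (by positivity)
    _ = _ := by ring

/-- The squared modulus `w² + w'²` of a function in the phase plane; for a Wolff function `w`, it
governs the size of the gradient of the Wolff solutions. -/
def wolffModulus (w : ℝ → ℝ) (s : ℝ) : ℝ := w s ^ 2 + deriv w s ^ 2

/-- The quantity `log (w² + w'²) + (2 - p) / (p - 1) * w'² / (w² + w'²)`, which is a first integral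
of the equation of the Wolff functions. -/
def wolffFirstIntegral (P : ℝ) (w : ℝ → ℝ) (s : ℝ) : ℝ :=
  Real.log (wolffModulus w s) + (2 - P) / (P - 1) * (deriv w s ^ 2 / wolffModulus w s)

namespace IsWolffFunction

theorem contDiff_deriv (hw : IsWolffFunction P w) : ContDiff ℝ ∞ (deriv w) :=
  (contDiff_infty_iff_deriv.1 hw.smooth).2

theorem hasDerivAt (hw : IsWolffFunction P w) (s : ℝ) : HasDerivAt w (deriv w s) s :=
  (hw.smooth.differentiable (by simp) s).hasDerivAt

theorem hasDerivAt_deriv (hw : IsWolffFunction P w) (s : ℝ) :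
    HasDerivAt (deriv w) (-(wolffV P (w s) (deriv w s) * w s)) s := by
  have hderiv := (hw.contDiff_deriv.differentiable (by simp) s).hasDerivAt
  rwa [eq_neg_of_add_eq_zero_left (hw.ode s)] at hderiv

theorem contDiff_modulus (hw : IsWolffFunction P w) : ContDiff ℝ ∞ (wolffModulus w) :=
  (hw.smooth.pow 2).add (hw.contDiff_deriv.pow 2)

theorem hasDerivAt_modulus (hw : IsWolffFunction P w) (s : ℝ) :
    HasDerivAt (wolffModulus w)
      (2 * w s * deriv w s * (1 - wolffV P (w s) (deriv w s))) s := by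
  refine (((hw.hasDerivAt s).pow 2).add ((hw.hasDerivAt_deriv s).pow 2)).congr_deriv ?_
  push_cast
  ring

theorem modulus_pos (hP : 1 < P) (hw : IsWolffFunction P w) (s : ℝ) : 0 < wolffModulus w s := by
  have hV (s : ℝ) : |1 - wolffV P (w s) (deriv w s)| ≤ 1 + (|2 * P - 3| / (P - 1) + (P - 1)) :=
    (abs_sub _ _).trans (by simpa only [abs_one, add_le_add_iff_left] using abs_wolffV_le hP _ _)
  have hmul (s : ℝ) : |2 * w s * deriv w s| ≤ wolffModulus w s := by
    simpa only [wolffModulus, abs_mul, abs_two, sq_abs] using two_mul_le_add_sq |w s| |deriv w s|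
  refine pos_of_abs_deriv_le (s₀ := 0) (K := 1 + (|2 * P - 3| / (P - 1) + (P - 1)))
    hw.hasDerivAt_modulus (fun s => ?_) ?_ s
  · rw [abs_mul, mul_comm]
    exact mul_le_mul (hV s) (hmul s) (abs_nonneg _) ((abs_nonneg _).trans (hV s))
  · rw [wolffModulus]
    rcases hw.nontrivial with h | h <;> positivity

theorem hasDerivAt_firstIntegral (hP : 1 < P) (hw : IsWolffFunction P w) (s : ℝ) :
    HasDerivAt (wolffFirstIntegral P w) 0 s := by
  have hpos : 0 < w s ^ 2 + deriv w s ^ 2 := hw.modulus_pos hP s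
  have hden := (wolffV_denominator_pos hP hpos).ne'
  have hP₀ : P - 1 ≠ 0 := (sub_pos.2 hP).ne'
  refine (((hw.hasDerivAt_modulus s).log hpos.ne').add ((((hw.hasDerivAt_deriv s).pow 2).div
    (hw.hasDerivAt_modulus s) hpos.ne').const_mul ((2 - P) / (P - 1)))).congr_deriv ?_
  simp only [wolffV, wolffModulus, Pi.pow_apply]
  have hpos' := hpos.ne'
  push_cast
  rw [mul_comm] at hden
  field_simp
  ring

theorem exists_modulus_bounds (hP : 1 < P) (hw : IsWolffFunction P w) :
    ∃ m M : ℝ, 0 < m ∧ ∀ s, m ≤ wolffModulus w s ∧ wolffModulus w s ≤ M := by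
  have hconst (s : ℝ) : wolffFirstIntegral P w s = wolffFirstIntegral P w 0 :=
    is_const_of_deriv_eq_zero (fun s => (hw.hasDerivAt_firstIntegral hP s).differentiableAt)
      (fun s => (hw.hasDerivAt_firstIntegral hP s).deriv) s 0
  set κ : ℝ := (2 - P) / (P - 1)
  have hcorrection (s : ℝ) : |κ * (deriv w s ^ 2 / wolffModulus w s)| ≤ |κ| := by
    have hpos := hw.modulus_pos hP s
    rw [abs_mul]
    refine mul_le_of_le_one_right (abs_nonneg _) ?_
    rw [abs_of_nonneg (by positivity), div_le_one hpos]
    exact le_add_of_nonneg_left (sq_nonneg _)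
  have hlog (s : ℝ) : |Real.log (wolffModulus w s) - wolffFirstIntegral P w 0| ≤ |κ| := by
    rw [← hconst s, wolffFirstIntegral, sub_add_cancel_left, abs_neg]
    exact hcorrection s
  refine ⟨Real.exp (wolffFirstIntegral P w 0 - |κ|), Real.exp (wolffFirstIntegral P w 0 + |κ|),
    Real.exp_pos _, fun s => ?_⟩
  have hpos := hw.modulus_pos hP s
  rw [← Real.le_log_iff_exp_le hpos, ← Real.log_le_iff_le_exp hpos]
  have h := abs_le.1 (hlog s)
  constructor <;> linarith

theorem hasDerivAt_flux (hP : 1 < P) (hw : IsWolffFunction P w) (s : ℝ) :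
    HasDerivAt (fun s => wolffModulus w s ^ ((P - 2) / 2) * deriv w s)
      (-(P - 1) * (wolffModulus w s ^ ((P - 2) / 2) * w s)) s := by
  have hpos : 0 < w s ^ 2 + deriv w s ^ 2 := hw.modulus_pos hP s
  have hden := (wolffV_denominator_pos hP hpos).ne'
  refine (((hw.hasDerivAt_modulus s).rpow_const (p := (P - 2) / 2) (Or.inl hpos.ne')).mul
    (hw.hasDerivAt_deriv s)).congr_deriv ?_
  have hpos' : wolffModulus w s ≠ 0 := hpos.ne'
  rw [Real.rpow_sub_one hpos']
  generalize wolffModulus w s ^ ((P - 2) / 2) = r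
  rw [wolffModulus] at hpos' ⊢
  rw [wolffV]
  rw [mul_comm] at hden
  field_simp
  ring

end IsWolffFunction

end WolffFunction

section WolffSolution

section ExpMul

variable {E : Type*} [NormedAddCommGroup E] [InnerProductSpace ℝ E] {F : ℝ → ℝ}

theorem hasFDerivAt_exp_mul {F' : ℝ} (c t τ : ℝ) (ρ ρ' : E) {x : E}
    (hF : HasDerivAt F F' (τ * inner ℝ ρ' x)) :
    HasFDerivAt (fun x => Real.exp (c * (inner ℝ ρ x - t)) * F (τ * inner ℝ ρ' x))
      (Real.exp (c * (inner ℝ ρ x - t)) • ((c * F (τ * inner ℝ ρ' x)) • innerSL ℝ ρ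
        + (τ * F') • innerSL ℝ ρ')) x := by
  have hexponent : HasFDerivAt (fun x => c * (inner ℝ ρ x - t)) (c • innerSL ℝ ρ) x :=
    ((innerSL ℝ ρ).hasFDerivAt.sub_const t).const_mul c
  have hargument : HasFDerivAt (fun x => τ * inner ℝ ρ' x) (τ • innerSL ℝ ρ') x :=
    (innerSL ℝ ρ').hasFDerivAt.const_mul τ
  refine (hexponent.exp.mul (hF.comp_hasFDerivAt x hargument)).congr_fderiv ?_
  ext y
  simp only [add_apply, smul_apply, innerSL_apply_apply, smul_eq_mul, Function.comp_apply]
  ring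

theorem contDiff_exp_mul {n : WithTop ℕ∞} (hF : ContDiff ℝ n F) (c t τ : ℝ) (ρ ρ' : E) :
    ContDiff ℝ n fun x => Real.exp (c * (inner ℝ ρ x - t)) * F (τ * inner ℝ ρ' x) := by
  have hinner (v : E) : ContDiff ℝ n fun x => inner ℝ v x := contDiff_const.inner ℝ contDiff_id
  exact (Real.contDiff_exp.comp (contDiff_const.mul ((hinner ρ).sub contDiff_const))).mul
    (hF.comp (contDiff_const.mul (hinner ρ')))

end ExpMul

variable {d : ℕ} {P : ℝ} {w : ℝ → ℝ} {t τ : ℝ} {ρ ρ' : Space d} {Ω : Set (Space d)}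

theorem integral_inner_exp_smul_gradient_eq_zero (hρ : ‖ρ‖ = 1) (hρ' : ‖ρ'‖ = 1)
    (hort : inner ℝ ρ ρ' = 0) {c : ℝ} {A B : ℝ → ℝ} (hA : ContDiff ℝ 1 A) (hB : ContDiff ℝ 1 B)
    (hAB : ∀ s, τ * deriv B s = -(c * A s)) {φ : Space d → ℝ} (hφ : IsTestFunction Ω φ) :
    ∫ x in Ω, inner ℝ (Real.exp (c * (inner ℝ ρ x - t)) •
      (A (τ * inner ℝ ρ' x) • ρ + B (τ * inner ℝ ρ' x) • ρ')) (gradient φ x) = 0 := by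
  set a : Space d → ℝ := fun x => Real.exp (c * (inner ℝ ρ x - t)) * A (τ * inner ℝ ρ' x)
  set b : Space d → ℝ := fun x => Real.exp (c * (inner ℝ ρ x - t)) * B (τ * inner ℝ ρ' x)
  have ha : ContDiff ℝ 1 a := contDiff_exp_mul hA _ _ _ _ _
  have hb : ContDiff ℝ 1 b := contDiff_exp_mul hB _ _ _ _ _
  have hdiv (x : Space d) : fderiv ℝ a x ρ = -fderiv ℝ b x ρ' := by
    have ha' := hasFDerivAt_exp_mul c t τ ρ ρ' (x := x)
      (hA.differentiable one_ne_zero _).hasDerivAt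
    have hb' := hasFDerivAt_exp_mul c t τ ρ ρ' (x := x)
      (hB.differentiable one_ne_zero _).hasDerivAt
    rw [ha'.fderiv, hb'.fderiv, hAB]
    simp only [smul_apply, add_apply, innerSL_apply_apply, real_inner_self_eq_norm_sq, hρ, hρ',
      hort, real_inner_comm ρ ρ', smul_eq_mul]
    ring
  have hinner (x : Space d) : inner ℝ (Real.exp (c * (inner ℝ ρ x - t)) •
      (A (τ * inner ℝ ρ' x) • ρ + B (τ * inner ℝ ρ' x) • ρ')) (gradient φ x)
      = fderiv ℝ φ x ρ * a x + fderiv ℝ φ x ρ' * b x := by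
    simp only [inner_gradient_right, map_smul, map_add, smul_eq_mul, RCLike.conj_to_real, a, b]
    ring
  have hintegrable (v : Space d) {h : Space d → ℝ} (hh : ContDiff ℝ 1 h) :
      Integrable (fun x => fderiv ℝ φ x v * h x) (volume.restrict Ω) := by
    have hφ' := hφ.contDiff_one
    have hcont : Continuous fun x => fderiv ℝ φ x v * h x := by fun_prop (disch := simp)
    exact (hcont.integrable_of_hasCompactSupport
      (hφ.compact.fderiv_apply ℝ v).mul_right).integrableOn
  simp only [hinner]
  rw [integral_add (hintegrable ρ ha) (hintegrable ρ' hb), hφ.setIntegral_fderiv_mul ha,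
    hφ.setIntegral_fderiv_mul hb]
  simp only [hdiv, mul_neg, integral_neg, neg_neg, add_neg_cancel]

namespace IsWolffFunction

theorem gradient_wolffSolution (hw : IsWolffFunction P w) (x : Space d) :
    gradient (wolffSolution w t ρ ρ' τ) x = (τ * Real.exp (τ * (inner ℝ ρ x - t))) •
      (w (τ * inner ℝ ρ' x) • ρ + deriv w (τ * inner ℝ ρ' x) • ρ') := by
  refine HasGradientAt.gradient (hasGradientAt_iff_hasFDerivAt.2 ?_)
  refine (hasFDerivAt_exp_mul τ t τ ρ ρ' (hw.hasDerivAt _)).congr_fderiv ?_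
  ext y
  simp only [smul_apply, add_apply, innerSL_apply_apply, smul_eq_mul,
    InnerProductSpace.toDual_apply_apply, real_inner_smul_left, inner_add_left]
  ring

theorem norm_gradient_wolffSolution_rpow (hw : IsWolffFunction P w) (hτ : 0 ≤ τ)
    (hρ : ‖ρ‖ = 1) (hρ' : ‖ρ'‖ = 1) (hort : inner ℝ ρ ρ' = 0) (x : Space d) (q : ℝ) :
    ‖gradient (wolffSolution w t ρ ρ' τ) x‖ ^ q = τ ^ q *
      Real.exp (q * τ * (inner ℝ ρ x - t)) * wolffModulus w (τ * inner ℝ ρ' x) ^ (q / 2) := by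
  have hmodulus : ‖w (τ * inner ℝ ρ' x) • ρ + deriv w (τ * inner ℝ ρ' x) • ρ'‖ ^ q
      = wolffModulus w (τ * inner ℝ ρ' x) ^ (q / 2) := by
    rw [← mul_div_cancel₀ q (two_ne_zero' ℝ), Real.rpow_mul (norm_nonneg _), Real.rpow_two,
      norm_add_sq_real]
    simp [norm_smul, hρ, hρ', hort, real_inner_smul_left, real_inner_smul_right, wolffModulus]
  rw [hw.gradient_wolffSolution, norm_smul, Real.norm_of_nonneg (by positivity),
    Real.mul_rpow (by positivity) (norm_nonneg _), hmodulus, Real.mul_rpow hτ (Real.exp_pos _).le,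
    ← Real.exp_mul]
  ring_nf

theorem norm_gradient_wolffSolution_rpow_smul (hw : IsWolffFunction P w) (hP : P ≠ 1)
    (hτ : 0 ≤ τ) (hρ : ‖ρ‖ = 1) (hρ' : ‖ρ'‖ = 1) (hort : inner ℝ ρ ρ' = 0) (x : Space d) :
    ‖gradient (wolffSolution w t ρ ρ' τ) x‖ ^ (P - 2) • gradient (wolffSolution w t ρ ρ' τ) x
      = τ ^ (P - 1) • Real.exp ((P - 1) * τ * (inner ℝ ρ x - t)) •
        ((wolffModulus w (τ * inner ℝ ρ' x) ^ ((P - 2) / 2) * w (τ * inner ℝ ρ' x)) • ρ +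
          (wolffModulus w (τ * inner ℝ ρ' x) ^ ((P - 2) / 2) * deriv w (τ * inner ℝ ρ' x)) •
            ρ') := by
  have hexp : Real.exp ((P - 1) * τ * (inner ℝ ρ x - t))
      = Real.exp ((P - 2) * τ * (inner ℝ ρ x - t)) * Real.exp (τ * (inner ℝ ρ x - t)) := by
    rw [← Real.exp_add]
    ring_nf
  rw [hw.norm_gradient_wolffSolution_rpow hτ hρ hρ' hort, hw.gradient_wolffSolution, hexp,
    ← rpow_sub_two_mul_self hP hτ]
  module

theorem integral_flux_wolffSolution_eq_zero (hw : IsWolffFunction P w) (hP : 1 < P)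
    (hτ : 0 ≤ τ) (hρ : ‖ρ‖ = 1) (hρ' : ‖ρ'‖ = 1) (hort : inner ℝ ρ ρ' = 0)
    {φ : Space d → ℝ} (hφ : IsTestFunction Ω φ) :
    ∫ x in Ω, ‖gradient (wolffSolution w t ρ ρ' τ) x‖ ^ (P - 2) *
      inner ℝ (gradient (wolffSolution w t ρ ρ' τ) x) (gradient φ x) = 0 := by
  have hrpow : ContDiff ℝ 1 fun s => wolffModulus w s ^ ((P - 2) / 2) :=
    (hw.contDiff_modulus.of_le (by simp)).rpow_const_of_ne fun s => (hw.modulus_pos hP s).ne'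
  have hflux (x : Space d) : ‖gradient (wolffSolution w t ρ ρ' τ) x‖ ^ (P - 2) *
      inner ℝ (gradient (wolffSolution w t ρ ρ' τ) x) (gradient φ x) = τ ^ (P - 1) *
        inner ℝ (Real.exp ((P - 1) * τ * (inner ℝ ρ x - t)) •
          ((wolffModulus w (τ * inner ℝ ρ' x) ^ ((P - 2) / 2) * w (τ * inner ℝ ρ' x)) • ρ +
            (wolffModulus w (τ * inner ℝ ρ' x) ^ ((P - 2) / 2) * deriv w (τ * inner ℝ ρ' x)) •
              ρ')) (gradient φ x) := by
    rw [← real_inner_smul_left, hw.norm_gradient_wolffSolution_rpow_smul hP.ne' hτ hρ hρ' hort,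
      real_inner_smul_left]
  simp only [hflux, integral_const_mul]
  rw [integral_inner_exp_smul_gradient_eq_zero hρ hρ' hort
    (A := fun s => wolffModulus w s ^ ((P - 2) / 2) * w s)
    (B := fun s => wolffModulus w s ^ ((P - 2) / 2) * deriv w s)
    (hrpow.mul (hw.smooth.of_le (by simp))) (hrpow.mul (hw.contDiff_deriv.of_le (by simp)))
    (fun s => ?_) hφ, mul_zero]
  rw [(hw.hasDerivAt_flux hP s).deriv]
  ring

theorem exists_isMinimizer_traceOf_wolffSolution {p : ℝ≥0∞} [Fact (1 ≤ p)]
    (hw : IsWolffFunction p.toReal w) (hp₁ : 1 < p) (hp : p ≠ ⊤) (hΩo : IsOpen Ω)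
    (hΩ : Bornology.IsBounded Ω) (hτ : 0 ≤ τ) (hρ : ‖ρ‖ = 1) (hρ' : ‖ρ'‖ = 1)
    (hort : inner ℝ ρ ρ' = 0) :
    ∃ u : sobolev p Ω, traceOf p Ω (wolffSolution w t ρ ρ' τ) = trace u ∧ IsMinimizer 1 u ∧
      grad u =ᵐ[volume.restrict Ω] gradient (wolffSolution w t ρ ρ' τ) := by
  have hsmooth : ContDiff ℝ 1 (wolffSolution w t ρ ρ' τ) :=
    contDiff_exp_mul (hw.smooth.of_le (by simp)) _ _ _ _ _
  obtain ⟨u, hu, hu_grad⟩ := exists_traceOf_eq (p := p) hΩo hΩ hsmooth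
  refine ⟨u, hu, isMinimizer_of_fluxPairing_eq_zero hp₁ hp isElliptic_one fun v hv => ?_, hu_grad⟩
  have hclosed : IsClosed {v : sobolev p Ω | fluxPairing 1 u v = 0} := by
    refine isClosed_eq (Continuous.congr ((lpFluxCLM hp₁ hp isElliptic_one (grad u)).continuous.comp
      (gradL p Ω).continuous) fun v => ?_) continuous_const
    exact lpFluxCLM_apply hp₁ hp isElliptic_one (grad u) (grad v)
  refine sobolevZero_induction hclosed (fun v φ hφ hv => ?_) hv
  refine Eq.trans (integral_congr_ae ?_) (hw.integral_flux_wolffSolution_eq_zero (t := t)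
    (one_lt_toReal hp₁ hp) hτ hρ hρ' hort hφ)
  filter_upwards [hu_grad, grad_ae_eq_gradient hΩo hΩ hφ.contDiff_one hv] with x hux hvx
  rw [hux, hvx, Pi.one_apply, one_mul]

end IsWolffFunction

end WolffSolution

section Monotonicity

theorem IsElliptic.rpow {α : Type*} [MeasurableSpace α] {σ : α → ℝ} (hσ : IsElliptic σ) (q : ℝ) :
    IsElliptic fun x => σ x ^ q := by
  obtain ⟨m, hm, hmσ⟩ := hσ.lower
  obtain ⟨M, hM⟩ := hσ.upper
  refine ⟨hσ.measurable.pow_const q, ⟨min (m ^ q) (max M m ^ q), ?_, fun x => ?_⟩,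
    ⟨max (m ^ q) (M ^ q), fun x => ?_⟩⟩
  · have : 0 < max M m := lt_max_of_lt_right hm
    positivity
  · rcases le_total 0 q with hq | hq
    · exact (min_le_left _ _).trans (Real.rpow_le_rpow hm.le (hmσ x) hq)
    · exact (min_le_right _ _).trans
        (Real.rpow_le_rpow_of_nonpos (hσ.pos x) ((hM x).trans (le_max_left _ _)) hq)
  · rcases le_total 0 q with hq | hq
    · exact (Real.rpow_le_rpow (hσ.pos x).le (hM x) hq).trans (le_max_right _ _)
    · exact (Real.rpow_le_rpow_of_nonpos hm (hmσ x) hq).trans (le_max_left _ _)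

variable {d : ℕ} {p : ℝ≥0∞} [Fact (1 ≤ p)] {Ω : Set (Space d)} {σ γ : Space d → ℝ}
  {u v : sobolev p Ω} {Λσ Λγ Λ₁ : BoundaryValues p Ω → StrongDual ℝ (BoundaryValues p Ω)}

theorem integrable_norm_grad_rpow (hp : p ≠ ⊤) (u : sobolev p Ω) :
    Integrable (fun x => ‖grad u x‖ ^ p.toReal) (volume.restrict Ω) :=
  (Lp.memLp (grad u)).integrable_norm_rpow (zero_lt_one.trans_le Fact.out).ne' hp

theorem fluxPairing_self (hp : p ≠ ⊤) (u : sobolev p Ω) : fluxPairing σ u u = energy σ u :=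
  lpFlux_self (zero_lt_one.trans_le Fact.out).ne' hp (grad u)

theorem IsMinimizer.fluxPairing_eq_energy (hu : IsMinimizer σ u) (hp₁ : 1 < p) (hp : p ≠ ⊤)
    (hσ : IsElliptic σ) (h : trace v = trace u) : fluxPairing σ u v = energy σ u := by
  rw [← add_sub_cancel u v, fluxPairing_add_right hp₁ hp hσ,
    hu.fluxPairing_eq_zero hp₁ hp hσ (trace_eq_iff.1 h), add_zero, fluxPairing_self hp]

theorem mul_fluxPairing_one_le (hp₁ : 1 < p) (hp : p ≠ ⊤) (hσ : IsElliptic σ)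
    (u v : sobolev p Ω) :
    p.toReal * fluxPairing 1 u v ≤ energy σ v +
      (p.toReal - 1) * ∫ x in Ω, σ x ^ (-1 / (p.toReal - 1)) * ‖grad u x‖ ^ p.toReal := by
  have hflux := integrable_flux hp₁ hp isElliptic_one (Lp.memLp (grad u)) (Lp.memLp (grad v))
  have henergy := hσ.integrable_mul (integrable_norm_grad_rpow hp v)
  have hdual := (hσ.rpow (-1 / (p.toReal - 1))).integrable_mul (integrable_norm_grad_rpow hp u)
  rw [fluxPairing, energy, ← integral_const_mul, ← integral_const_mul,
    ← integral_add henergy (hdual.const_mul _)]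
  refine integral_mono (hflux.const_mul _) (henergy.add (hdual.const_mul _)) fun x => ?_
  simpa only [Pi.one_apply, one_mul, ← mul_assoc] using
    norm_rpow_mul_inner_le_weighted (one_lt_toReal hp₁ hp) (hσ.pos x) (grad u x) (grad v x)

theorem energy_sub_energy (hp : p ≠ ⊤) (hσ : IsElliptic σ) (hγ : IsElliptic γ)
    (u : sobolev p Ω) :
    energy σ u - energy γ u = ∫ x in Ω, (σ x - γ x) * ‖grad u x‖ ^ p.toReal := by
  have hgrad := integrable_norm_grad_rpow hp u
  simp only [sub_mul]
  exact (integral_sub (hσ.integrable_mul hgrad) (hγ.integrable_mul hgrad)).symm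

namespace IsDNMap

theorem apply_self (hΛσ : IsDNMap σ Λσ) (hp : p ≠ ⊤) (hu : IsMinimizer σ u) :
    Λσ (trace u) (trace u) = energy σ u := by
  rw [hΛσ.pairing u u hu, fluxPairing_self hp]

theorem exists_sub_apply_self_eq (hΛσ : IsDNMap σ Λσ) (hΛγ : IsDNMap γ Λγ) (hp : p ≠ ⊤)
    (hu : IsMinimizer γ u) :
    ∃ v : sobolev p Ω, trace v = trace u ∧ IsMinimizer σ v ∧
      (Λσ (trace u) - Λγ (trace u)) (trace u) = energy σ v - energy γ u := by
  obtain ⟨v, hv, hv_min⟩ := hΛσ.exists_minimizer (trace u)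
  refine ⟨v, hv, hv_min, ?_⟩
  rw [sub_apply, hΛγ.apply_self hp hu, ← hv, hΛσ.apply_self hp hv_min]

theorem sub_apply_self_le (hΛσ : IsDNMap σ Λσ) (hΛγ : IsDNMap γ Λγ) (hp : p ≠ ⊤)
    (hσ : IsElliptic σ) (hγ : IsElliptic γ) (hu : IsMinimizer γ u) :
    (Λσ (trace u) - Λγ (trace u)) (trace u)
      ≤ ∫ x in Ω, (σ x - γ x) * ‖grad u x‖ ^ p.toReal := by
  obtain ⟨v, hv, hv_min, hgap⟩ := hΛσ.exists_sub_apply_self_eq hΛγ hp hu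
  rw [hgap, ← energy_sub_energy hp hσ hγ]
  exact sub_le_sub_right (hv_min u hv.symm) _

theorem le_sub_apply_self (hΛσ : IsDNMap σ Λσ) (hΛ₁ : IsDNMap 1 Λ₁) (hp₁ : 1 < p) (hp : p ≠ ⊤)
    (hσ : IsElliptic σ) (hu : IsMinimizer 1 u) :
    ∫ x in Ω, (p.toReal - 1) * (1 - σ x ^ (-1 / (p.toReal - 1))) * ‖grad u x‖ ^ p.toReal
      ≤ (Λσ (trace u) - Λ₁ (trace u)) (trace u) := by
  obtain ⟨v, hv, -, hgap⟩ := hΛσ.exists_sub_apply_self_eq hΛ₁ hp hu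
  have hyoung := mul_fluxPairing_one_le hp₁ hp hσ u v
  have hsplit := energy_sub_energy hp isElliptic_one (hσ.rpow (-1 / (p.toReal - 1))) u
  rw [hu.fluxPairing_eq_energy hp₁ hp isElliptic_one hv] at hyoung
  simp only [energy, Pi.one_apply] at hsplit hyoung hgap
  simp only [mul_assoc (p.toReal - 1)]
  rw [integral_const_mul, hgap, ← hsplit]
  linarith

end IsDNMap

end Monotonicity

section Separation

variable {E : Type*} [NormedAddCommGroup E] [InnerProductSpace ℝ E]

theorem exists_norm_eq_one_inner_eq_zero (hE : 1 < Module.finrank ℝ E) (ρ : E) :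
    ∃ ρ' : E, ‖ρ'‖ = 1 ∧ inner ℝ ρ ρ' = 0 := by
  have hne : (ℝ ∙ ρ)ᗮ ≠ ⊥ := fun hbot => hE.not_ge <| finrank_le_one ρ fun v =>
    Submodule.mem_span_singleton.1 (Submodule.orthogonal_eq_bot_iff.1 hbot ▸ Submodule.mem_top)
  have := Submodule.nontrivial_iff_ne_bot.2 hne
  obtain ⟨ρ', hρ'⟩ := exists_norm_eq (ℝ ∙ ρ)ᗮ zero_le_one
  exact ⟨ρ', hρ', Submodule.mem_orthogonal_singleton_iff_inner_right.1 ρ'.2⟩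

theorem exists_unit_separation [CompleteSpace E] [Nontrivial E] {D : Set E} {x : E}
    (hx : x ∉ closure (convexHull ℝ D)) :
    ∃ (ρ : E) (s : ℝ), ‖ρ‖ = 1 ∧ (∀ y ∈ D, inner ℝ ρ y ≤ s) ∧ s < inner ℝ ρ x := by
  rcases D.eq_empty_or_nonempty with rfl | ⟨y₀, hy₀⟩
  · obtain ⟨ρ, hρ⟩ := exists_norm_eq E zero_le_one
    exact ⟨ρ, inner ℝ ρ x - 1, hρ, by simp, sub_one_lt _⟩
  obtain ⟨f, s, hfD, hfx⟩ := geometric_hahn_banach_closed_point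
    (convex_convexHull ℝ D).closure isClosed_closure hx
  obtain ⟨v, rfl⟩ := (InnerProductSpace.toDual ℝ E).surjective f
  simp only [InnerProductSpace.toDual_apply_apply] at hfD hfx
  replace hfD (y : E) (hy : y ∈ D) : inner ℝ v y < s :=
    hfD y (subset_closure (subset_convexHull ℝ D hy))
  have hv : 0 < ‖v‖ := norm_pos_iff.2 fun hv₀ => by
    have hlt := (hfD y₀ hy₀).trans hfx
    simp [hv₀] at hlt
  refine ⟨‖v‖⁻¹ • v, ‖v‖⁻¹ * s, norm_smul_inv_norm (norm_pos_iff.1 hv), fun y hy => ?_, ?_⟩ <;>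
    rw [real_inner_smul_left]
  · gcongr
    exact (hfD y hy).le
  · gcongr

theorem interior_eq_convexHull {D S : Set E} (hD : IsOpen D) (hS : Convex ℝ S) (hDS : D ⊆ S)
    (hSD : S ⊆ closure (convexHull ℝ D)) : interior S = convexHull ℝ D := by
  have hopen : IsOpen (convexHull ℝ D) := hD.convexHull
  refine Set.Subset.antisymm ?_ (interior_maximal (convexHull_min hDS hS) hopen)
  rcases D.eq_empty_or_nonempty with rfl | hne
  · exact interior_subset.trans (hSD.trans (by simp))
  calc interior S ⊆ interior (closure (convexHull ℝ D)) := interior_mono hSD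
    _ = convexHull ℝ D := by
      rw [(convex_convexHull ℝ D).interior_closure_eq_interior_of_nonempty_interior,
        hopen.interior_eq]
      rw [hopen.interior_eq]
      exact hne.convexHull

theorem interior_setOf_inner_le_eq_convexHull [CompleteSpace E] [Nontrivial E] {D : Set E}
    (hD : IsOpen D) {A : E → ℝ → Prop} (hA : ∀ ρ t, A ρ t → ∀ x ∈ D, inner ℝ ρ x ≤ t)
    (hA_of_lt : ∀ ρ s t, ‖ρ‖ = 1 → s < t → (∀ x ∈ D, inner ℝ ρ x ≤ s) → A ρ t) :
    interior {x | ∀ ρ t, A ρ t → inner ℝ ρ x ≤ t} = convexHull ℝ D := by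
  refine interior_eq_convexHull hD ?_ (fun x hx ρ t hρ => hA ρ t hρ x hx) fun x hx => ?_
  · simp only [Set.ofPred_forall]
    exact convex_iInter fun ρ => convex_iInter₂ fun t _ =>
      convex_halfSpace_le (innerSL ℝ ρ).isLinear t
  · by_contra hx_notMem
    obtain ⟨ρ, s, hρ, hD_le, hlt⟩ := exists_unit_separation hx_notMem
    obtain ⟨t, hst, htx⟩ := exists_between hlt
    exact htx.not_ge (hx ρ t (hA_of_lt ρ s t hρ hst hD_le))

end Separation

section ExpWeight

variable {d : ℕ} {D : Set (Space d)} {P t : ℝ} {ρ : Space d}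

/-- The weight `∫_D exp (P τ (ρ · x - t)) dx`, whose growth in `τ` tells whether `D` lies in the
half-space `{ρ · x ≤ t}`. It is comparable with the `p`-energy in `D` of the Wolff solution, up to
the factor `τ ^ p`. -/
def expWeight (D : Set (Space d)) (P t : ℝ) (ρ : Space d) (τ : ℝ) : ℝ :=
  ∫ x in D, Real.exp (P * τ * (inner ℝ ρ x - t))

theorem expWeight_nonneg (D : Set (Space d)) (P t : ℝ) (ρ : Space d) (τ : ℝ) :
    0 ≤ expWeight D P t ρ τ :=
  integral_nonneg fun _ => (Real.exp_pos _).le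

theorem integrableOn_expWeight (hD : Bornology.IsBounded D) (P t : ℝ) (ρ : Space d) (τ : ℝ) :
    IntegrableOn (fun x => Real.exp (P * τ * (inner ℝ ρ x - t))) D :=
  memLp_one_iff_integrable.1 (memLp_restrict_of_continuous hD (by fun_prop))

theorem expWeight_pos (hD : Bornology.IsBounded D) (hDo : IsOpen D) (hne : D.Nonempty)
    (P t : ℝ) (ρ : Space d) (τ : ℝ) : 0 < expWeight D P t ρ τ := by
  have : NeZero (volume.restrict D) :=
    ⟨Measure.restrict_eq_zero.not.2 (hDo.measure_pos volume hne).ne'⟩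
  exact integral_exp_pos (integrableOn_expWeight hD P t ρ τ)

theorem tendsto_rpow_mul_expWeight (hD : Bornology.IsBounded D) (hDm : MeasurableSet D) (q : ℝ)
    (hP : 0 < P) {s : ℝ} (hst : s < t) (h : ∀ x ∈ D, inner ℝ ρ x ≤ s) :
    Tendsto (fun τ : ℝ => τ ^ q * expWeight D P t ρ τ) atTop (𝓝 0) := by
  have hbound {τ : ℝ} (hτ : 0 ≤ τ) :
      expWeight D P t ρ τ ≤ Real.exp (-(P * (t - s)) * τ) * volume.real D := by
    rw [mul_comm, ← smul_eq_mul, ← setIntegral_const]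
    refine setIntegral_mono_on (integrableOn_expWeight hD P t ρ τ)
      (integrableOn_const hD.measure_lt_top.ne) hDm fun x hx => Real.exp_le_exp.2 ?_
    calc P * τ * (inner ℝ ρ x - t) ≤ P * τ * (s - t) := by gcongr; exact h x hx
      _ = -(P * (t - s)) * τ := by ring
  have hlim := (tendsto_rpow_mul_exp_neg_mul_atTop_nhds_zero q (P * (t - s))
    (mul_pos hP (sub_pos.2 hst))).mul_const (volume.real D)
  rw [zero_mul] at hlim
  refine squeeze_zero' ?_ ?_ hlim <;> filter_upwards [eventually_ge_atTop 0] with τ hτ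
  · exact mul_nonneg (by positivity) (expWeight_nonneg _ _ _ _ _)
  · rw [mul_assoc]
    gcongr
    exact hbound hτ

theorem not_tendsto_rpow_mul_expWeight (hD : Bornology.IsBounded D) (hDo : IsOpen D) {q : ℝ}
    (hq : 0 ≤ q) (hP : 0 ≤ P) {x₀ : Space d} (hx₀ : x₀ ∈ D) (ht : t < inner ℝ ρ x₀) :
    ¬ Tendsto (fun τ : ℝ => τ ^ q * expWeight D P t ρ τ) atTop (𝓝 0) := by
  set H : Set (Space d) := {x | t < inner ℝ ρ x}
  have hH : IsOpen H := isOpen_lt continuous_const (by fun_prop)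
  have hpos : 0 < (volume.restrict D).real H := by
    rw [measureReal_restrict_apply hH.measurableSet]
    exact ENNReal.toReal_pos ((hH.inter hDo).measure_pos volume ⟨x₀, ht, hx₀⟩).ne'
      (hD.subset Set.inter_subset_right).measure_lt_top.ne
  have hbound {τ : ℝ} (hτ : 0 ≤ τ) : (volume.restrict D).real H ≤ expWeight D P t ρ τ := by
    have hmarkov := mul_meas_ge_le_integral_of_nonneg (ae_of_all _ fun x => (Real.exp_pos _).le)
      (integrableOn_expWeight hD P t ρ τ) 1
    rw [one_mul] at hmarkov
    have : IsFiniteMeasure (volume.restrict D) :=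
      isFiniteMeasure_restrict.2 hD.measure_lt_top.ne
    refine (measureReal_mono fun x (hx : t < inner ℝ ρ x) => ?_).trans hmarkov
    exact Real.one_le_exp (mul_nonneg (mul_nonneg hP hτ) (sub_nonneg.2 hx.le))
  refine fun hlim => hpos.not_ge (ge_of_tendsto hlim ?_)
  filter_upwards [eventually_ge_atTop 1] with τ hτ
  exact (hbound (zero_le_one.trans hτ)).trans
    (le_mul_of_one_le_left (expWeight_nonneg _ _ _ _ _) (Real.one_le_rpow hτ hq))

end ExpWeight

section Asymptotics

variable {α : Type*} {l : Filter α} {f g : α → ℝ} {k K : ℝ}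

theorem isTheta_of_mul_le_of_le_mul_of_pos (hg : ∀ᶠ x in l, 0 ≤ g x) (hk : 0 < k)
    (hkf : ∀ᶠ x in l, k * g x ≤ f x) (hfK : ∀ᶠ x in l, f x ≤ K * g x) : f =Θ[l] g := by
  refine ⟨Asymptotics.IsBigO.of_bound K ?_, Asymptotics.IsBigO.of_bound k⁻¹ ?_⟩ <;>
    filter_upwards [hg, hkf, hfK] with x hgx hkfx hfKx <;>
    rw [Real.norm_of_nonneg hgx, Real.norm_of_nonneg ((mul_nonneg hk.le hgx).trans hkfx)]
  · exact hfKx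
  · rwa [le_inv_mul_iff₀ hk]

theorem isTheta_of_mul_le_of_le_mul (hg : ∀ᶠ x in l, 0 ≤ g x) (hkK : 0 < k ∨ K < 0)
    (hkf : ∀ᶠ x in l, k * g x ≤ f x) (hfK : ∀ᶠ x in l, f x ≤ K * g x) : f =Θ[l] g := by
  rcases hkK with hk | hK
  · exact isTheta_of_mul_le_of_le_mul_of_pos hg hk hkf hfK
  · have hneg : (fun x => -f x) =Θ[l] g := by
      refine isTheta_of_mul_le_of_le_mul_of_pos (K := -k) hg (neg_pos.2 hK) ?_ ?_
      · filter_upwards [hfK] with x hx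
        rwa [neg_mul, neg_le_neg_iff]
      · filter_upwards [hkf] with x hx
        rwa [neg_mul, neg_le_neg_iff]
    exact Asymptotics.isTheta_norm_left.1 (by simpa only [norm_neg] using hneg.norm_left)

end Asymptotics

section SetIntegral

variable {α : Type*} [MeasurableSpace α] {μ : Measure α} {s t : Set α} {a g : α → ℝ} {b : ℝ}

theorem setIntegral_mul_le_of_le_on (hs : MeasurableSet s) (ht : MeasurableSet t) (hst : s ⊆ t)
    (hzero : ∀ x ∈ t \ s, a x = 0) (hag : IntegrableOn (fun x => a x * g x) s μ)
    (hg : IntegrableOn g s μ) (hg_nonneg : ∀ x ∈ s, 0 ≤ g x) (hab : ∀ x ∈ s, a x ≤ b) :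
    ∫ x in t, a x * g x ∂μ ≤ b * ∫ x in s, g x ∂μ := by
  rw [setIntegral_eq_of_subset_of_forall_sdiff_eq_zero ht hst
    fun x hx => mul_eq_zero_of_left (hzero x hx) _, ← integral_const_mul]
  exact setIntegral_mono_on hag (hg.const_mul b) hs
    fun x hx => mul_le_mul_of_nonneg_right (hab x hx) (hg_nonneg x hx)

theorem le_setIntegral_mul_of_le_on (hs : MeasurableSet s) (ht : MeasurableSet t) (hst : s ⊆ t)
    (hzero : ∀ x ∈ t \ s, a x = 0) (hag : IntegrableOn (fun x => a x * g x) s μ)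
    (hg : IntegrableOn g s μ) (hg_nonneg : ∀ x ∈ s, 0 ≤ g x) (hba : ∀ x ∈ s, b ≤ a x) :
    b * ∫ x in s, g x ∂μ ≤ ∫ x in t, a x * g x ∂μ := by
  rw [setIntegral_eq_of_subset_of_forall_sdiff_eq_zero ht hst
    fun x hx => mul_eq_zero_of_left (hzero x hx) _, ← integral_const_mul]
  exact setIntegral_mono_on (hg.const_mul b) hag hs
    fun x hx => mul_le_mul_of_nonneg_right (hba x hx) (hg_nonneg x hx)

end SetIntegral

section Inclusion

variable {d : ℕ} {p : ℝ≥0∞} [Fact (1 ≤ p)] {Ω D : Set (Space d)} {σD : Space d → ℝ} {P a b : ℝ}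

theorem inclusionConductivity_of_mem {x : Space d} (hx : x ∈ D) :
    inclusionConductivity D σD x = 1 + σD x := by
  rw [inclusionConductivity, Set.indicator_of_mem hx]

theorem inclusionConductivity_of_notMem {x : Space d} (hx : x ∉ D) :
    inclusionConductivity D σD x = 1 := by
  rw [inclusionConductivity, Set.indicator_of_notMem hx, add_zero]

theorem isElliptic_inclusionConductivity (hmeas : Measurable (inclusionConductivity D σD))
    (ha : 0 < 1 + a) (h : ∀ x ∈ D, a ≤ σD x ∧ σD x ≤ b) :
    IsElliptic (inclusionConductivity D σD) := by
  refine ⟨hmeas, ⟨min 1 (1 + a), lt_min one_pos ha, fun x => ?_⟩, ⟨max 1 (1 + b), fun x => ?_⟩⟩ <;>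
    by_cases hx : x ∈ D
  · rw [inclusionConductivity_of_mem hx]
    exact min_le_of_right_le ((add_le_add_iff_left 1).2 (h x hx).1)
  · rw [inclusionConductivity_of_notMem hx]
    exact min_le_left _ _
  · rw [inclusionConductivity_of_mem hx]
    exact le_max_of_le_right ((add_le_add_iff_left 1).2 (h x hx).2)
  · rw [inclusionConductivity_of_notMem hx]
    exact le_max_left _ _

/-- The contrast `(p - 1) (1 - (1 + a) ^ (-1 / (p - 1)))` of the dual problem, which takes the
place of `a` in the lower monotonicity estimate for the conductivity `1 + a`. -/
def dualContrast (P a : ℝ) : ℝ := (P - 1) * (1 - (1 + a) ^ (-1 / (P - 1)))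

theorem dualContrast_pos (hP : 1 < P) (ha : 0 < a) : 0 < dualContrast P a := by
  have hP₀ : 0 < P - 1 := sub_pos.2 hP
  refine mul_pos hP₀ (sub_pos.2 (Real.rpow_lt_one_of_one_lt_of_neg (lt_add_of_pos_right 1 ha) ?_))
  exact div_neg_of_neg_of_pos (neg_lt_zero.2 one_pos) hP₀

theorem dualContrast_le_dualContrast (hP : 1 < P) (ha : 0 < 1 + a) (hab : a ≤ b) :
    dualContrast P a ≤ dualContrast P b := by
  have hP₀ : 0 < P - 1 := sub_pos.2 hP
  have hrpow : (1 + b) ^ (-1 / (P - 1)) ≤ (1 + a) ^ (-1 / (P - 1)) :=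
    Real.rpow_le_rpow_of_nonpos ha (by gcongr)
      (div_nonpos_of_nonpos_of_nonneg (neg_nonpos.2 zero_le_one) hP₀.le)
  unfold dualContrast
  gcongr

namespace IsDNMap

variable {Λσ Λ₁ : BoundaryValues p Ω → StrongDual ℝ (BoundaryValues p Ω)} {u : sobolev p Ω}

theorem inclusion_sub_apply_self_le (hΛσ : IsDNMap (inclusionConductivity D σD) Λσ)
    (hΛ₁ : IsDNMap 1 Λ₁) (hp : p ≠ ⊤) (hσ : IsElliptic (inclusionConductivity D σD))
    (hΩ : MeasurableSet Ω) (hD : MeasurableSet D) (hDΩ : D ⊆ Ω) (hb : ∀ x ∈ D, σD x ≤ b)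
    (hu : IsMinimizer 1 u) :
    (Λσ (trace u) - Λ₁ (trace u)) (trace u) ≤ b * ∫ x in D, ‖grad u x‖ ^ p.toReal := by
  have hgrad : IntegrableOn (fun x => ‖grad u x‖ ^ p.toReal) D :=
    IntegrableOn.mono_set (integrable_norm_grad_rpow hp u) hDΩ
  refine (hΛσ.sub_apply_self_le hΛ₁ hp hσ isElliptic_one hu).trans
    (setIntegral_mul_le_of_le_on hD hΩ hDΩ (fun x hx => ?_) ?_ hgrad
      (fun x _ => by positivity) fun x hx => ?_)
  · rw [inclusionConductivity_of_notMem hx.2, Pi.one_apply, sub_self]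
  · simp only [sub_mul]
    exact (hσ.integrable_mul hgrad).sub (isElliptic_one.integrable_mul hgrad)
  · rw [inclusionConductivity_of_mem hx, Pi.one_apply, add_sub_cancel_left]
    exact hb x hx

theorem le_inclusion_sub_apply_self (hΛσ : IsDNMap (inclusionConductivity D σD) Λσ)
    (hΛ₁ : IsDNMap 1 Λ₁) (hp₁ : 1 < p) (hp : p ≠ ⊤)
    (hσ : IsElliptic (inclusionConductivity D σD)) (hΩ : MeasurableSet Ω) (hD : MeasurableSet D)
    (hDΩ : D ⊆ Ω) (ha : 0 < 1 + a) (haD : ∀ x ∈ D, a ≤ σD x) (hu : IsMinimizer 1 u) :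
    dualContrast p.toReal a * ∫ x in D, ‖grad u x‖ ^ p.toReal
      ≤ (Λσ (trace u) - Λ₁ (trace u)) (trace u) := by
  have hgrad : IntegrableOn (fun x => ‖grad u x‖ ^ p.toReal) D :=
    IntegrableOn.mono_set (integrable_norm_grad_rpow hp u) hDΩ
  refine (le_setIntegral_mul_of_le_on hD hΩ hDΩ (fun x hx => ?_) ?_ hgrad
    (fun x _ => by positivity) fun x hx => ?_).trans (hΛσ.le_sub_apply_self hΛ₁ hp₁ hp hσ hu)
  · rw [inclusionConductivity_of_notMem hx.2, Real.one_rpow, sub_self, mul_zero]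
  · simp only [mul_assoc, one_sub_mul]
    exact (hgrad.sub ((hσ.rpow _).integrable_mul hgrad)).const_mul _
  · rw [inclusionConductivity_of_mem hx]
    exact dualContrast_le_dualContrast (one_lt_toReal hp₁ hp) ha (haD x hx)

end IsDNMap

end Inclusion

section WolffEnergy

variable {d : ℕ} {D : Set (Space d)} {P t τ : ℝ} {w : ℝ → ℝ} {ρ ρ' : Space d}

/-- The `p`-energy in `D` of the Wolff solution, scaled by the factor `τ ^ (d - p)` of the
indicator function. -/
def wolffEnergy (D : Set (Space d)) (P : ℝ) (w : ℝ → ℝ) (t : ℝ) (ρ ρ' : Space d) (τ : ℝ) : ℝ :=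
  τ ^ ((d : ℝ) - P) * ∫ x in D, ‖gradient (wolffSolution w t ρ ρ' τ) x‖ ^ P

theorem wolffEnergy_nonneg (D : Set (Space d)) (P : ℝ) (w : ℝ → ℝ) (t : ℝ) (ρ ρ' : Space d)
    (hτ : 0 ≤ τ) : 0 ≤ wolffEnergy D P w t ρ ρ' τ :=
  mul_nonneg (by positivity) (integral_nonneg fun x => by positivity)

namespace IsWolffFunction

theorem wolffEnergy_eq (hw : IsWolffFunction P w) (hτ : 0 < τ) (hρ : ‖ρ‖ = 1) (hρ' : ‖ρ'‖ = 1)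
    (hort : inner ℝ ρ ρ' = 0) :
    wolffEnergy D P w t ρ ρ' τ = τ ^ (d : ℝ) * ∫ x in D,
      wolffModulus w (τ * inner ℝ ρ' x) ^ (P / 2) * Real.exp (P * τ * (inner ℝ ρ x - t)) := by
  simp only [wolffEnergy, hw.norm_gradient_wolffSolution_rpow hτ.le hρ hρ' hort, mul_assoc,
    integral_const_mul]
  rw [← mul_assoc, ← Real.rpow_add hτ, sub_add_cancel]
  simp only [mul_comm]

theorem wolffEnergy_bounds (hw : IsWolffFunction P w) (hD : Bornology.IsBounded D) (hP : 0 ≤ P)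
    {m M : ℝ} (hm : 0 < m) (hmM : ∀ s, m ≤ wolffModulus w s ∧ wolffModulus w s ≤ M)
    (hτ : 0 < τ) (hρ : ‖ρ‖ = 1) (hρ' : ‖ρ'‖ = 1) (hort : inner ℝ ρ ρ' = 0) :
    m ^ (P / 2) * (τ ^ (d : ℝ) * expWeight D P t ρ τ) ≤ wolffEnergy D P w t ρ ρ' τ ∧
      wolffEnergy D P w t ρ ρ' τ ≤ M ^ (P / 2) * (τ ^ (d : ℝ) * expWeight D P t ρ τ) := by
  have hexp := integrableOn_expWeight hD P t ρ τ
  have hmodulus : Continuous fun x : Space d => wolffModulus w (τ * inner ℝ ρ' x) ^ (P / 2) :=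
    (hw.contDiff_modulus.continuous.comp (by fun_prop)).rpow_const
      fun x => Or.inl (hm.trans_le (hmM _).1).ne'
  have hint : IntegrableOn (fun x => wolffModulus w (τ * inner ℝ ρ' x) ^ (P / 2) *
      Real.exp (P * τ * (inner ℝ ρ x - t))) D :=
    memLp_one_iff_integrable.1 (memLp_restrict_of_continuous hD (hmodulus.mul (by fun_prop)))
  have hlower : m ^ (P / 2) * expWeight D P t ρ τ ≤ ∫ x in D,
      wolffModulus w (τ * inner ℝ ρ' x) ^ (P / 2) * Real.exp (P * τ * (inner ℝ ρ x - t)) := by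
    rw [expWeight, ← integral_const_mul]
    refine integral_mono (hexp.const_mul _) hint fun x => ?_
    dsimp only
    gcongr
    exact (hmM _).1
  have hupper : ∫ x in D,
      wolffModulus w (τ * inner ℝ ρ' x) ^ (P / 2) * Real.exp (P * τ * (inner ℝ ρ x - t))
        ≤ M ^ (P / 2) * expWeight D P t ρ τ := by
    rw [expWeight, ← integral_const_mul]
    refine integral_mono hint (hexp.const_mul _) fun x => ?_
    have hpos := hm.le.trans (hmM (τ * inner ℝ ρ' x)).1
    dsimp only
    gcongr
    exact (hmM _).2
  rw [hw.wolffEnergy_eq hτ hρ hρ' hort, mul_left_comm, mul_left_comm (M ^ _)]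
  constructor <;> gcongr

theorem isTheta_wolffEnergy (hw : IsWolffFunction P w) (hP : 1 < P)
    (hD : Bornology.IsBounded D) (t : ℝ) (hρ : ‖ρ‖ = 1) (hρ' : ‖ρ'‖ = 1)
    (hort : inner ℝ ρ ρ' = 0) :
    wolffEnergy D P w t ρ ρ' =Θ[atTop] fun τ => τ ^ (d : ℝ) * expWeight D P t ρ τ := by
  have hP₀ : 0 ≤ P := zero_le_one.trans hP.le
  obtain ⟨m, M, hm, hmM⟩ := hw.exists_modulus_bounds hP
  refine isTheta_of_mul_le_of_le_mul_of_pos (k := m ^ (P / 2)) (K := M ^ (P / 2)) ?_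
    (by positivity) ?_ ?_ <;>
    filter_upwards [eventually_gt_atTop 0] with τ hτ
  · exact mul_nonneg (by positivity) (expWeight_nonneg _ _ _ _ _)
  · exact (hw.wolffEnergy_bounds hD hP₀ hm hmM hτ hρ hρ' hort).1
  · exact (hw.wolffEnergy_bounds hD hP₀ hm hmM hτ hρ hρ' hort).2

theorem wolffEnergy_pos (hw : IsWolffFunction P w) (hP : 1 < P) (hD : Bornology.IsBounded D)
    (hDo : IsOpen D) (hne : D.Nonempty) (t : ℝ) (hτ : 0 < τ) (hρ : ‖ρ‖ = 1) (hρ' : ‖ρ'‖ = 1)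
    (hort : inner ℝ ρ ρ' = 0) : 0 < wolffEnergy D P w t ρ ρ' τ := by
  obtain ⟨m, M, hm, hmM⟩ := hw.exists_modulus_bounds hP
  have hweight := expWeight_pos hD hDo hne P t ρ τ
  exact lt_of_lt_of_le (by positivity)
    (hw.wolffEnergy_bounds hD (zero_le_one.trans hP.le) hm hmM hτ hρ hρ' hort).1

end IsWolffFunction

end WolffEnergy

section Contrast

variable {ι : Type*} {s : Set ι} {f : ι → ℝ} {a b k E I : ℝ}

theorem exists_contrast_bounds
    (hf : (∃ c C : ℝ, 0 < c ∧ ∀ x ∈ s, c ≤ f x ∧ f x ≤ C) ∨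
      (∃ c : ℝ, 0 < c ∧ ∀ x ∈ s, -1 + c ≤ f x ∧ f x ≤ -c)) :
    ∃ a b : ℝ, 0 < 1 + a ∧ (∀ x ∈ s, a ≤ f x ∧ f x ≤ b) ∧ (0 < a ∨ b < 0) := by
  rcases hf with ⟨c, C, hc, hf⟩ | ⟨c, hc, hf⟩
  · exact ⟨c, C, by positivity, hf, .inl hc⟩
  · exact ⟨-1 + c, -c, by simpa using hc, hf, .inr (neg_lt_zero.2 hc)⟩

theorem forall_pos_iff_and_forall_neg_iff (hs : s.Nonempty)
    (hf : ∀ x ∈ s, a ≤ f x ∧ f x ≤ b) (hab : 0 < a ∨ b < 0) (hk : 0 < a → 0 < k)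
    (hE : 0 < E) (hkI : k * E ≤ I) (hIb : I ≤ b * E) :
    ((∀ x ∈ s, 0 < f x) ↔ 0 < I) ∧ ((∀ x ∈ s, f x < 0) ↔ I < 0) := by
  obtain ⟨x₀, hx₀⟩ := hs
  rcases hab with ha | hb
  · have hI : 0 < I := (mul_pos (hk ha) hE).trans_le hkI
    have hpos : ∀ x ∈ s, 0 < f x := fun x hx => ha.trans_le (hf x hx).1
    exact ⟨iff_of_true hpos hI, iff_of_false (fun h => (h x₀ hx₀).not_gt (hpos x₀ hx₀)) hI.not_gt⟩
  · have hI : I < 0 := hIb.trans_lt (mul_neg_of_neg_of_pos hb hE)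
    have hneg : ∀ x ∈ s, f x < 0 := fun x hx => (hf x hx).2.trans_lt hb
    exact ⟨iff_of_false (fun h => (h x₀ hx₀).not_gt (hneg x₀ hx₀)) hI.not_gt, iff_of_true hneg hI⟩

end Contrast

section Enclosure

variable {d : ℕ} {p : ℝ≥0∞} [Fact (1 ≤ p)] {Ω D : Set (Space d)} {σD : Space d → ℝ} {a b : ℝ}
  {w : ℝ → ℝ} {t τ : ℝ} {ρ ρ' : Space d}
  {Λ : BoundaryValues p Ω → StrongDual ℝ (BoundaryValues p Ω)}

theorem indicatorFunction_bounds (hp₁ : 1 < p) (hp : p ≠ ⊤) (hΩo : IsOpen Ω)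
    (hΩ : Bornology.IsBounded Ω) (hD : MeasurableSet D) (hDΩ : D ⊆ Ω)
    (hσ : IsElliptic (inclusionConductivity D σD))
    (hΛ : IsDNMap (inclusionConductivity D σD) Λ) (hΛ₁ : IsDNMap 1 (dnMap p Ω 1))
    (ha : 0 < 1 + a) (hab : ∀ x ∈ D, a ≤ σD x ∧ σD x ≤ b) (hw : IsWolffFunction p.toReal w)
    (t : ℝ) (hτ : 0 ≤ τ) (hρ : ‖ρ‖ = 1) (hρ' : ‖ρ'‖ = 1) (hort : inner ℝ ρ ρ' = 0) :
    dualContrast p.toReal a * wolffEnergy D p.toReal w t ρ ρ' τ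
        ≤ indicatorFunction p Ω w Λ t ρ ρ' τ ∧
      indicatorFunction p Ω w Λ t ρ ρ' τ ≤ b * wolffEnergy D p.toReal w t ρ ρ' τ := by
  obtain ⟨u, hu, hu_min, hu_grad⟩ :=
    hw.exists_isMinimizer_traceOf_wolffSolution (t := t) hp₁ hp hΩo hΩ hτ hρ hρ' hort
  have henergy : wolffEnergy D p.toReal w t ρ ρ' τ
      = τ ^ ((d : ℝ) - p.toReal) * ∫ x in D, ‖grad u x‖ ^ p.toReal := by
    rw [wolffEnergy]
    congr 1
    refine integral_congr_ae ?_
    filter_upwards [ae_restrict_of_ae_restrict_of_subset hDΩ hu_grad] with x hx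
    rw [hx]
  have hscale : 0 ≤ τ ^ ((d : ℝ) - p.toReal) := by positivity
  have hlower := hΛ.le_inclusion_sub_apply_self hΛ₁ hp₁ hp hσ hΩo.measurableSet hD hDΩ ha
    (fun x hx => (hab x hx).1) hu_min
  have hupper := hΛ.inclusion_sub_apply_self_le hΛ₁ hp hσ hΩo.measurableSet hD hDΩ
    (fun x hx => (hab x hx).2) hu_min
  simp only [indicatorFunction, hu]
  rw [henergy, mul_left_comm (dualContrast _ _), mul_left_comm b]
  exact ⟨mul_le_mul_of_nonneg_left hlower hscale, mul_le_mul_of_nonneg_left hupper hscale⟩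

theorem enclosure_eq_convexHull (hd : 1 < d) {P : ℝ} (hP : 0 < P) (hD : Bornology.IsBounded D)
    (hDo : IsOpen D)
    (hI : ∀ (t : ℝ) (ρ ρ' : Space d), ‖ρ‖ = 1 → ‖ρ'‖ = 1 → inner ℝ ρ ρ' = 0 →
      indicatorFunction p Ω w Λ t ρ ρ' =Θ[atTop] fun τ => τ ^ (d : ℝ) * expWeight D P t ρ τ) :
    enclosure p Ω w Λ = convexHull ℝ D := by
  let A (ρ : Space d) (t : ℝ) : Prop := ∃ ρ' : Space d, ‖ρ‖ = 1 ∧ ‖ρ'‖ = 1 ∧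
    inner ℝ ρ ρ' = 0 ∧ Tendsto (indicatorFunction p Ω w Λ t ρ ρ') atTop (𝓝 0)
  have henclosure : enclosure p Ω w Λ = interior {x | ∀ ρ t, A ρ t → inner ℝ ρ x ≤ t} := by
    unfold enclosure
    congr 1
    ext x
    exact ⟨fun hx ρ t ⟨ρ', hρ, hρ', hort, hlim⟩ => hx ρ ρ' t hρ hρ' hort hlim,
      fun hx ρ ρ' t hρ hρ' hort hlim => hx ρ t ⟨ρ', hρ, hρ', hort, hlim⟩⟩
  have hfinrank : 1 < Module.finrank ℝ (Space d) := by rwa [finrank_euclideanSpace_fin]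
  have : Nontrivial (Space d) :=
    Module.nontrivial_of_finrank_pos (R := ℝ) (zero_lt_one.trans hfinrank)
  rw [henclosure]
  refine interior_setOf_inner_le_eq_convexHull hDo ?_ ?_
  · rintro ρ t ⟨ρ', hρ, hρ', hort, hlim⟩ x hx
    by_contra! ht
    exact not_tendsto_rpow_mul_expWeight hD hDo (Nat.cast_nonneg d) hP.le hx ht
      ((hI t ρ ρ' hρ hρ' hort).tendsto_zero_iff.1 hlim)
  · intro ρ s t hρ hst hs
    obtain ⟨ρ', hρ', hort⟩ := exists_norm_eq_one_inner_eq_zero hfinrank ρ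
    exact ⟨ρ', hρ, hρ', hort, (hI t ρ ρ' hρ hρ' hort).tendsto_zero_iff.2
      (tendsto_rpow_mul_expWeight hD hDo.measurableSet d hP hst hs)⟩

end Enclosure

end PCalderon

end

open PCalderon in
theorem mainTheorem2_general {d : ℕ} (hd : 2 ≤ d) (p : ℝ≥0∞) [Fact (1 ≤ p)] (hp₁ : 1 < p)
    (hp : p ≠ ⊤) (Ω : Set (Space d)) (hΩ_open : IsOpen Ω) (hΩ_bdd : Bornology.IsBounded Ω)
    (D : Set (Space d)) (hD_open : IsOpen D) (hD_sub : D ⊆ Ω) (σD : Space d → ℝ)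
    (hσ_meas : Measurable (inclusionConductivity D σD))
    (hσ : (∃ c C : ℝ, 0 < c ∧ ∀ x ∈ D, c ≤ σD x ∧ σD x ≤ C) ∨
      (∃ c : ℝ, 0 < c ∧ ∀ x ∈ D, -1 + c ≤ σD x ∧ σD x ≤ -c)) :
    IsDNMap (inclusionConductivity D σD)
        (dnMap p Ω (inclusionConductivity D σD)) ∧
      IsDNMap 1 (dnMap p Ω 1) ∧
      (∃ w : ℝ → ℝ, IsWolffFunction p.toReal w) ∧
      ∀ w : ℝ → ℝ, IsWolffFunction p.toReal w →
        enclosure p Ω w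
            (dnMap p Ω (inclusionConductivity D σD)) = convexHull ℝ D ∧
        (D.Nonempty → ∀ (t τ : ℝ) (ρ ρ' : Space d),
          0 < τ → ‖ρ‖ = 1 → ‖ρ'‖ = 1 → inner ℝ ρ ρ' = 0 →
          ((∀ x ∈ D, 0 < σD x) ↔ 0 < indicatorFunction p Ω w
            (dnMap p Ω (inclusionConductivity D σD)) t ρ ρ' τ) ∧
          ((∀ x ∈ D, σD x < 0) ↔ indicatorFunction p Ω w
            (dnMap p Ω (inclusionConductivity D σD)) t ρ ρ' τ < 0)) := by
  have hP := one_lt_toReal hp₁ hp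
  have hD_bdd := hΩ_bdd.subset hD_sub
  obtain ⟨a, b, ha, hab, hsign⟩ := exists_contrast_bounds hσ
  have hσ_ell := isElliptic_inclusionConductivity hσ_meas ha hab
  have hΛσ := isDNMap_dnMap (p := p) hd hp₁ hp hΩ_open hΩ_bdd hσ_ell
  have hΛ₁ := isDNMap_dnMap (p := p) hd hp₁ hp hΩ_open hΩ_bdd isElliptic_one
  refine ⟨hΛσ, hΛ₁, exists_isWolffFunction hP, fun w hw => ?_⟩
  have hI {τ : ℝ} (hτ : 0 ≤ τ) (t : ℝ) (ρ ρ' : Space d) :=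
    indicatorFunction_bounds (ρ := ρ) (ρ' := ρ') hp₁ hp hΩ_open hΩ_bdd hD_open.measurableSet
      hD_sub hσ_ell hΛσ hΛ₁ ha hab hw t hτ
  refine ⟨enclosure_eq_convexHull hd (zero_lt_one.trans hP) hD_bdd hD_open
    fun t ρ ρ' hρ hρ' hort => ?_, fun hne t τ ρ ρ' hτ hρ hρ' hort => ?_⟩
  · refine (isTheta_of_mul_le_of_le_mul ?_ (hsign.imp_left (dualContrast_pos hP)) ?_ ?_).trans
      (hw.isTheta_wolffEnergy hP hD_bdd t hρ hρ' hort) <;>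
      filter_upwards [eventually_ge_atTop 0] with τ hτ
    · exact wolffEnergy_nonneg _ _ _ _ _ _ hτ
    · exact (hI hτ t ρ ρ' hρ hρ' hort).1
    · exact (hI hτ t ρ ρ' hρ hρ' hort).2
  · obtain ⟨hlower, hupper⟩ := hI hτ.le t ρ ρ' hρ hρ' hort
    exact forall_pos_iff_and_forall_neg_iff hne hab hsign (dualContrast_pos hP)
      (hw.wolffEnergy_pos hP hD_bdd hD_open hne t hτ hρ hρ' hort) hlower hupper

theorem mainTheorem2 {d : ℕ} (hd : 2 ≤ d) (p : ENNReal) [Fact (1 ≤ p)] (hp₁ : 1 < p) (hp : p ≠ ⊤)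
    (Ω : Set (PCalderon.Space d)) (hΩ_open : IsOpen Ω) (hΩ_conn : IsConnected Ω)
    (hΩ_bdd : Bornology.IsBounded Ω)
    (D : Set (PCalderon.Space d)) (hD_open : IsOpen D) (hD_sub : D ⊆ Ω)
    (hD_lip : PCalderon.HasLipschitzBoundary D)
    (σD : PCalderon.Space d → ℝ)
    (hσ_meas : Measurable (PCalderon.inclusionConductivity D σD))
    (hσ : (∃ c C : ℝ, 0 < c ∧ ∀ x ∈ D, c ≤ σD x ∧ σD x ≤ C) ∨
      (∃ c : ℝ, 0 < c ∧ ∀ x ∈ D, -1 + c ≤ σD x ∧ σD x ≤ -c)) :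
    -- the Dirichlet-to-Neumann maps of `σ` and of the background conductivity are well defined
    PCalderon.IsDNMap (PCalderon.inclusionConductivity D σD)
        (PCalderon.dnMap p Ω (PCalderon.inclusionConductivity D σD)) ∧
      PCalderon.IsDNMap 1 (PCalderon.dnMap p Ω 1) ∧
      -- Wolff functions exist
      (∃ w : ℝ → ℝ, PCalderon.IsWolffFunction p.toReal w) ∧
      ∀ w : ℝ → ℝ, PCalderon.IsWolffFunction p.toReal w →
        -- the convex hull of `D` is recovered from the Dirichlet-to-Neumann map
        PCalderon.enclosure p Ω w
            (PCalderon.dnMap p Ω (PCalderon.inclusionConductivity D σD)) = convexHull ℝ D ∧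
        -- the sign of `σ_D` is recovered from the Dirichlet-to-Neumann map
        (D.Nonempty → ∀ (t τ : ℝ) (ρ ρ' : PCalderon.Space d),
          0 < τ → ‖ρ‖ = 1 → ‖ρ'‖ = 1 → inner ℝ ρ ρ' = 0 →
          ((∀ x ∈ D, 0 < σD x) ↔ 0 < PCalderon.indicatorFunction p Ω w
            (PCalderon.dnMap p Ω (PCalderon.inclusionConductivity D σD)) t ρ ρ' τ) ∧
          ((∀ x ∈ D, σD x < 0) ↔ PCalderon.indicatorFunction p Ω w
            (PCalderon.dnMap p Ω (PCalderon.inclusionConductivity D σD)) t ρ ρ' τ < 0)) :=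
  mainTheorem2_general hd p hp₁ hp Ω hΩ_open hΩ_bdd D hD_open hD_sub σD hσ_meas hσ
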